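/- Let $u$ be an integer with $u\equiv 1 \pmod 4$ such that $p=u^2+64$ is prime, and let $M$ be an odd squarefree integer (of either sign) prime to $p$. Consider the elliptic curves over $\mathbb{Q}$ $$A^{(M)}: y^2=x^3-2uMx^2+pM^2x,\qquad A'^{(M)}: y^2=x^3+4uMx^2-256M^2x,$$ and the $2$-isogeny $$\hat\phi: A'^{(M)}\to A^{(M)},\qquad (x,y)\mapsto\left(\frac{y^2}{4x^2},\ \frac{y(-256M^2-x^2)}{8x^2}\right),$$ whose kernel is $\{O,(0,0)\}$. Let $$S^{(\hat\phi)}(A'^{(M)})=\ker\Big(H^1(\mathbb{Q},A'^{(M)}[\hat\phi])\to\prod_v H^1(\mathbb{Q}_v,A'^{(M)})\Big)$$ ($v$ running over all places of $\mathbb{Q}$) be the Selmer group of $\hat\phi$, regarded as a subgroup of $\mathbb{Q}^\times/(\mathbb{Q}^\times)^2$ through the identification $H^1(\mathbb{Q},A'^{(M)}[\hat\phi])=\mathbb{Q}^\times/(\mathbb{Q}^\times)^2$. For an odd squarefree integer $D$ let $D_+$ denote the product of the primes dividing $D$ which are $\equiv 1\pmod 4$. Let $N$ be the product of the primes dividing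 $M$ which split in $\mathbb{Q}(\sqrt p)$, and let $\left(\frac{\cdot}{q}\right)$ be the Legendre symbol. Then $S^{(\hat\phi)}(A'^{(M)})$ consists exactly of the classes in $\mathbb{Q}^\times/(\mathbb{Q}^\times)^2$ represented by the integers $d$ and $pd$, where $d$ runs over all integers satisfying the following conditions: 1. $d$ divides $M_+$ and $d>0$; 2. $d\equiv 1\pmod 4$ if $M\equiv 1\pmod 4$, and $d\equiv 1\pmod 8$ if $M\equiv 3\pmod 4$; 3. $\left(\frac{d}{q}\right)=1$ for all primes $q$ dividing $N/(N,d)$, and $\left(\frac{M/d}{q}\right)=\left(\frac{u+8b}{q}\right)$ for all primes $q$ dividing $(N_+,d)$, where $b$ is an integer satisfying $b^2\equiv -1\pmod q$. -/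

import Mathlib

open scoped IntermediateField NumberField

/-! ### The curves and the isogeny -/

/-- The curve `A^{(M)} : y² = x³ - 2uM x² + pM² x` over `ℚ`, where `p = u² + 64`. -/
def curveA (u M : ℤ) : WeierstrassCurve ℚ :=
  ⟨0, -2 * u * M, 0, (u ^ 2 + 64) * M ^ 2, 0⟩

/-- The curve `A'^{(M)} : y² = x³ + 4uM x² - 256M² x` over `ℚ`. -/
def curveA' (u M : ℤ) : WeierstrassCurve ℚ :=
  ⟨0, 4 * u * M, 0, -256 * M ^ 2, 0⟩

/-- The group of points of `A^{(M)}` over an extension field `L` of `ℚ`. -/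
abbrev PointA (u M : ℤ) (L : Type*) [Field L] [Algebra ℚ L] : Type _ :=
  ((curveA u M).baseChange L).toAffine.Point

/-- The group of points of `A'^{(M)}` over an extension field `L` of `ℚ`. -/
abbrev PointA' (u M : ℤ) (L : Type*) [Field L] [Algebra ℚ L] : Type _ :=
  ((curveA' u M).baseChange L).toAffine.Point

section Isogeny

variable {L : Type*} [Field L] [Algebra ℚ L]

theorem equation_curveA_iff (u M : ℤ) (x y : L) :
    ((curveA u M).baseChange L).toAffine.Equation x y ↔
      y ^ 2 = x ^ 3 - 2 * u * M * x ^ 2 + (u ^ 2 + 64) * M ^ 2 * x := by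
  have := algebraRat.charZero L
  simp [WeierstrassCurve.Affine.equation_iff, curveA, WeierstrassCurve.baseChange]
  constructor <;> intro h <;> linear_combination h

theorem equation_curveA'_iff (u M : ℤ) (x y : L) :
    ((curveA' u M).baseChange L).toAffine.Equation x y ↔
      y ^ 2 = x ^ 3 + 4 * u * M * x ^ 2 - 256 * M ^ 2 * x := by
  have := algebraRat.charZero L
  simp [WeierstrassCurve.Affine.equation_iff, curveA', WeierstrassCurve.baseChange]
  constructor <;> intro h <;> linear_combination h

theorem nonsingular_curveA {u M : ℤ} (hM : M ≠ 0) {x y : L}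
    (h : ((curveA u M).baseChange L).toAffine.Equation x y) :
    ((curveA u M).baseChange L).toAffine.Nonsingular x y := by
  refine (WeierstrassCurve.Affine.equation_iff_nonsingular_of_Δ_ne_zero ?_).mp h
  have hM' : (M : ℚ) ≠ 0 := by exact_mod_cast hM
  have h0 : (curveA u M).Δ ≠ 0 := by
    have : (curveA u M).Δ = -(4096 * ((u : ℚ) ^ 2 + 64) ^ 2 * (M : ℚ) ^ 6) := by
      simp only [WeierstrassCurve.Δ, WeierstrassCurve.b₂, WeierstrassCurve.b₄,
        WeierstrassCurve.b₆, WeierstrassCurve.b₈, curveA]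
      ring
    rw [this]
    have : (0 : ℚ) < (u : ℚ) ^ 2 + 64 := by positivity
    exact neg_ne_zero.mpr (by positivity)
  have h1 : ((curveA u M).baseChange L).Δ = algebraMap ℚ L (curveA u M).Δ :=
    WeierstrassCurve.map_Δ _ _
  exact h1 ▸ (map_ne_zero _).mpr h0

/-- The isogeny `φ̂ : A'^{(M)} → A^{(M)}`,
`(x, y) ↦ (y² / 4x², y(-256M² - x²) / 8x²)`, on points over an extension field of `ℚ`;
it sends `O` and `(0, 0)` to `O`. -/
noncomputable def phiHat {u M : ℤ} (hM : M ≠ 0) : PointA' u M L → PointA u M L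
  | .zero => .zero
  | .some x y h =>
    open Classical in
    if hx : x = 0 then .zero
    else .some (y ^ 2 / (4 * x ^ 2)) (y * (-256 * M ^ 2 - x ^ 2) / (8 * x ^ 2))
      (nonsingular_curveA hM <| by
        have := algebraRat.charZero L
        have e := (equation_curveA'_iff u M x y).mp h.1
        have e2 : y ^ 2 / (4 * x ^ 2) = (x ^ 2 + 4 * u * M * x - 256 * M ^ 2) / (4 * x) := by
          rw [e]; field_simp
        have e3 : (y * (-256 * M ^ 2 - x ^ 2) / (8 * x ^ 2)) ^ 2
            = (x ^ 2 + 4 * u * M * x - 256 * M ^ 2) * (-256 * M ^ 2 - x ^ 2) ^ 2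
              / (64 * x ^ 3) := by
          rw [div_pow, mul_pow, e]; field_simp; ring
        rw [equation_curveA_iff, e3, e2]
        field_simp
        ring)

/-- The point `(0, 0)` of `A'^{(M)}`. -/
noncomputable def pointT {u M : ℤ} (hM : M ≠ 0) : PointA' u M L :=
  .some 0 0 <| by
    have := algebraRat.charZero L
    have hM' : (M : L) ≠ 0 := by exact_mod_cast hM
    simp [WeierstrassCurve.Affine.nonsingular_iff, WeierstrassCurve.Affine.equation_iff,
      curveA', WeierstrassCurve.baseChange, hM]

/-- The kernel of `φ̂` is `{O, (0, 0)}`. -/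
theorem phiHat_eq_zero_iff {u M : ℤ} (hM : M ≠ 0) (P : PointA' u M L) :
    phiHat hM P = 0 ↔ P = 0 ∨ P = pointT hM := by
  match P with
  | .zero => simp [phiHat, WeierstrassCurve.Affine.Point.zero_def]
  | .some x y h =>
    by_cases hx : x = 0
    · have hy : y = 0 := by
        have e := (equation_curveA'_iff u M x y).mp h.1
        simpa [hx] using e
      simp [phiHat, pointT, hx, hy, WeierstrassCurve.Affine.Point.zero_def]
    · simp [phiHat, pointT, hx, WeierstrassCurve.Affine.Point.zero_def]

open Classical in
theorem pointT_add_pointT {u M : ℤ} (hM : M ≠ 0) :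
    (pointT hM + pointT hM : PointA' u M L) = 0 := by
  apply WeierstrassCurve.Affine.Point.add_self_of_Y_eq
  simp [WeierstrassCurve.Affine.negY, curveA', WeierstrassCurve.baseChange]

end Isogeny

/-! ### The Selmer group -/

/-- The group `ℚˣ / (ℚˣ)²`. -/
abbrev SquareClassGroup : Type := ℚˣ ⧸ (powMonoidHom 2 : ℚˣ →* ℚˣ).range

section Local

variable {K : Type*} [Field K] [Algebra ℚ K]

/-- `σ` fixes the square roots of `d` in the algebraic closure of `K`. -/
def FixesSqrt (d : ℚˣ) (σ : AlgebraicClosure K ≃ₐ[K] AlgebraicClosure K) : Prop :=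
  ∀ r : AlgebraicClosure K, r ^ 2 = algebraMap ℚ (AlgebraicClosure K) d → σ r = r

theorem fixesSqrt_iff {d : ℚˣ} {σ : AlgebraicClosure K ≃ₐ[K] AlgebraicClosure K}
    {r : AlgebraicClosure K} (hr : r ^ 2 = algebraMap ℚ (AlgebraicClosure K) d) :
    FixesSqrt d σ ↔ σ r = r := by
  refine ⟨fun h => h r hr, fun h s hs => ?_⟩
  rcases sq_eq_sq_iff_eq_or_eq_neg.mp (hs.trans hr.symm) with rfl | rfl
  · exact h
  · rw [map_neg, h]

theorem exists_sqrt (K : Type*) [Field K] [Algebra ℚ K] (d : ℚˣ) :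
    ∃ r : AlgebraicClosure K, r ≠ 0 ∧ r ^ 2 = algebraMap ℚ (AlgebraicClosure K) d := by
  obtain ⟨r, hr⟩ := IsAlgClosed.exists_pow_nat_eq
    (algebraMap ℚ (AlgebraicClosure K) d) (n := 2) (by norm_num)
  refine ⟨r, ?_, hr⟩
  rintro rfl
  have : algebraMap ℚ (AlgebraicClosure K) d = 0 := by rw [← hr]; simp
  exact d.ne_zero ((map_eq_zero _).mp this)

theorem map_sqrt {d : ℚˣ} (σ : AlgebraicClosure K ≃ₐ[K] AlgebraicClosure K)
    {r : AlgebraicClosure K} (hr : r ^ 2 = algebraMap ℚ (AlgebraicClosure K) d) :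
    σ r = r ∨ σ r = -r := by
  apply sq_eq_sq_iff_eq_or_eq_neg.mp
  rw [← map_pow, hr, IsScalarTower.algebraMap_apply ℚ K (AlgebraicClosure K), σ.commutes]

theorem fixesSqrt_one (σ : AlgebraicClosure K ≃ₐ[K] AlgebraicClosure K) : FixesSqrt 1 σ :=
  (fixesSqrt_iff (r := 1) (by simp)).mpr (map_one σ)

theorem fixesSqrt_inv (d : ℚˣ) (σ : AlgebraicClosure K ≃ₐ[K] AlgebraicClosure K) :
    FixesSqrt d⁻¹ σ ↔ FixesSqrt d σ := by
  obtain ⟨r, hr0, hr⟩ := exists_sqrt K d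
  rw [fixesSqrt_iff hr, fixesSqrt_iff (r := r⁻¹) (by rw [inv_pow, hr]; simp), map_inv₀, inv_inj]

theorem fixesSqrt_mul (d e : ℚˣ) (σ : AlgebraicClosure K ≃ₐ[K] AlgebraicClosure K) :
    FixesSqrt (d * e) σ ↔ (FixesSqrt d σ ↔ FixesSqrt e σ) := by
  have := algebraRat.charZero (AlgebraicClosure K)
  obtain ⟨r, hr0, hr⟩ := exists_sqrt K d
  obtain ⟨s, hs0, hs⟩ := exists_sqrt K e
  rw [fixesSqrt_iff hr, fixesSqrt_iff hs,
    fixesSqrt_iff (r := r * s) (by rw [mul_pow, hr, hs]; simp), map_mul]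
  rcases map_sqrt σ hr with h | h <;> rcases map_sqrt σ hs with h' | h' <;>
    rw [h, h'] <;> simp [neg_eq_self, hr0, hs0]

open Classical in
/-- The action of `σ` on the points of `A'^{(M)}` over the algebraic closure of `K`. -/
noncomputable def galAct {u M : ℤ} (σ : AlgebraicClosure K ≃ₐ[K] AlgebraicClosure K) :
    PointA' u M (AlgebraicClosure K) →+ PointA' u M (AlgebraicClosure K) :=
  WeierstrassCurve.Affine.Point.map (W' := curveA' u M) (S := K) σ.toAlgHom

open Classical in
/-- For an extension `K` of `ℚ`, the class of `d` is trivial in `H¹(K, A'^{(M)})`.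

The kernel `A'^{(M)}[φ̂]` has order two, so `H¹(K, A'^{(M)}[φ̂]) = Kˣ / (Kˣ)²`, the class of `d`
corresponding to the cocycle with values in `A'^{(M)}[φ̂]` which vanishes exactly at those `σ`
that fix `√d`. The condition says that this cocycle is the coboundary `σ ↦ σP - P` of a point `P`
of `A'^{(M)}` over the algebraic closure of `K`. -/
def IsTrivialOver (u : ℤ) {M : ℤ} (hM : M ≠ 0) (d : ℚˣ) (K : Type*) [Field K] [Algebra ℚ K] :
    Prop :=
  ∃ P : PointA' u M (AlgebraicClosure K), ∀ σ : AlgebraicClosure K ≃ₐ[K] AlgebraicClosure K,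
    phiHat hM (galAct σ P - P) = 0 ∧ (galAct σ P - P = 0 ↔ FixesSqrt d σ)

theorem isTrivialOver_one (u : ℤ) {M : ℤ} (hM : M ≠ 0) (K : Type*) [Field K] [Algebra ℚ K] :
    IsTrivialOver u hM 1 K :=
  ⟨0, fun σ => by simp [phiHat_eq_zero_iff, fixesSqrt_one]⟩

theorem IsTrivialOver.inv {u M : ℤ} {hM : M ≠ 0} {d : ℚˣ} (h : IsTrivialOver u hM d K) :
    IsTrivialOver u hM d⁻¹ K := by
  obtain ⟨P, hP⟩ := h
  exact ⟨P, fun σ => by rw [fixesSqrt_inv]; exact hP σ⟩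

theorem IsTrivialOver.mul {u M : ℤ} {hM : M ≠ 0} {d e : ℚˣ} (hd : IsTrivialOver u hM d K)
    (he : IsTrivialOver u hM e K) : IsTrivialOver u hM (d * e) K := by
  classical
  obtain ⟨P, hP⟩ := hd
  obtain ⟨Q, hQ⟩ := he
  refine ⟨P + Q, fun σ => ?_⟩
  have key : galAct σ (P + Q) - (P + Q) = (galAct σ P - P) + (galAct σ Q - Q) := by
    rw [map_add]; abel
  have hT : (pointT hM : PointA' u M (AlgebraicClosure K)) ≠ 0 :=
    WeierstrassCurve.Affine.Point.some_ne_zero _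
  obtain ⟨h1, h2⟩ := hP σ
  obtain ⟨h3, h4⟩ := hQ σ
  rw [key, fixesSqrt_mul, ← h2, ← h4]
  rw [phiHat_eq_zero_iff] at h1 h3 ⊢
  rcases h1 with h1 | h1 <;> rcases h3 with h3 | h3 <;> rw [h1, h3] <;>
    simp [hT, pointT_add_pointT]

end Local

/-- The Selmer group `S^{(φ̂)}(A'^{(M)})`, that is, the kernel of
`H¹(ℚ, A'^{(M)}[φ̂]) → ∏_v H¹(ℚ_v, A'^{(M)})`, where `v` runs over all places of `ℚ` and where
`H¹(ℚ, A'^{(M)}[φ̂])` is identified with `ℚˣ / (ℚˣ)²`. -/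
def phiHatSelmer (u : ℤ) {M : ℤ} (hM : M ≠ 0) : Subgroup SquareClassGroup :=
  Subgroup.map (QuotientGroup.mk' _)
    { carrier := {d | IsTrivialOver u hM d ℝ ∧
        ∀ (q : ℕ) [Fact q.Prime], IsTrivialOver u hM d ℚ_[q]}
      one_mem' := ⟨isTrivialOver_one u hM ℝ, fun _ _ => isTrivialOver_one u hM _⟩
      mul_mem' := fun h h' => ⟨h.1.mul h'.1, fun q _ => (h.2 q).mul (h'.2 q)⟩
      inv_mem' := fun h => ⟨h.1.inv, fun q _ => (h.2 q).inv⟩ }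

/-! ### The factors of `M` -/

/-- The prime number `q` splits in `ℚ(√p)`: there are two primes of `ℚ(√p)` above `q`. -/
def SplitsIn (p q : ℕ) : Prop :=
  ((Ideal.span {(q : ℤ)}).primesOver (𝓞 ℚ⟮√(p : ℝ)⟯)).ncard = 2

open Classical in
/-- The product `N` of the prime factors of `M` which split in `ℚ(√p)`. -/
noncomputable def splitPart (p : ℕ) (M : ℤ) : ℕ :=
  ∏ q ∈ M.natAbs.primeFactors with SplitsIn p q, q

/-- The product `D₊` of the prime factors of `D` which are congruent to `1` modulo `4`. -/
def plusPart (D : ℤ) : ℕ :=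
  ∏ q ∈ D.natAbs.primeFactors with q % 4 = 1, q

/-!
The class of `d` becomes trivial in `H¹(K, A')` exactly when the torsor
`(d z² - uM)² + 64 M² = d w²` under `A'` has a `K`-point, possibly at infinity: a point `P` of `A'`
over the algebraic closure, with `σP - P` given by the cocycle of `√d`, yields the fixed elements
`z = y / (2x√d)` and `w`, and conversely (`isTrivialOver_iff`). So the Selmer group is a question
about local solubility of these torsors, for `d` a squarefree integer. The class of `p = u² + 64` is
always trivial, through `z = 0` (it is the image of `(0, 0)`), so `d` may be taken prime to `p`.

The local answers are as follows.

* Over `ℝ` the left side is positive, so `d > 0` (`torsorSoluble_real_iff`).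
* At a prime not dividing `pM`, valuations show that `d` has even valuation
  (`TorsorSoluble.not_dvd`). At an odd prime not dividing `dM`, including `p`, there is always a
  point: `∑ χ(x² + a x + b) = -1` produces one over the residue field, and Hensel's lemma lifts it
  (`torsorSoluble_of_not_dvd`).
* At `q ∣ M`, `q ∤ d`, solubility means that `d` or `pd` is a square: no condition if `q` is inert in
  `ℚ(√p)`, and `d` a square modulo `q` if `q` splits (`TorsorSoluble.isSquare_zmod`,
  `torsorSoluble_of_not_isSquare`).
* At `q ∣ M`, `q ∣ d`, the left side must vanish to higher order, which forces `q ≡ 1` modulo `4`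
  and, writing `b² = -1`, that `(M / d) (u + 8b)` is a square for a choice of `b`
  (`TorsorSoluble.exists_sq_eq_neg_one`, `torsorSoluble_of_dvd`). As `(u + 8b) (u - 8b) = p`, a
  suitable `b` always exists if `q` is inert, and the choice does not matter if `q` splits.
* All prime factors of `d` are now `≡ 1` modulo `4`, so `d ≡ 1` or `5` modulo `8`. In `ℚ₂` the
  former is a square, and the latter is soluble if and only if `M ≡ 1` modulo `4`
  (`torsorSoluble_two_of_modEq_five`, `not_torsorSoluble_two`).

The residue conditions at the split primes are phrased through `SplitsIn`, which
`splitsIn_iff` identifies with `p` being a square modulo `q`.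
-/

/-! ### Galois descent: rational points of the torsors -/

section Descent

/-- A point `(x, y)` of `A'` whose Galois orbit is governed by `r = √d` gives a rational point of
the torsor: `y / (2xr)` and `(-256M² - x²) / (4xr)` are fixed by Galois. -/
theorem exists_torsor_point_of_forall_galois {F : Type*} [Field F] [CharZero F] {u M : ℤ}
    {δ : F} {r x y : AlgebraicClosure F}
    (hr0 : r ≠ 0) (hr : r ^ 2 = algebraMap F (AlgebraicClosure F) δ) (hx : x ≠ 0)
    (e : y ^ 2 = x ^ 3 + 4 * u * M * x ^ 2 - 256 * M ^ 2 * x)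
    (key : ∀ σ : AlgebraicClosure F ≃ₐ[F] AlgebraicClosure F, (σ r = r ∧ σ x = x ∧ σ y = y) ∨
      (σ r = -r ∧ σ x = -256 * M ^ 2 / x ∧ σ y = 256 * M ^ 2 * y / x ^ 2)) (hM : M ≠ 0) :
    ∃ z w : F, (δ * z ^ 2 - u * M) ^ 2 + 64 * M ^ 2 = δ * w ^ 2 := by
  have hM' : (M : AlgebraicClosure F) ≠ 0 := by exact_mod_cast hM
  have h1 : y / (2 * x * r) ∈ Set.range (algebraMap F (AlgebraicClosure F)) := by
    rw [InfiniteGalois.mem_range_algebraMap_iff_fixed]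
    intro σ
    rw [map_div₀, map_mul, map_mul, map_ofNat]
    rcases key σ with ⟨h0, h1, h2⟩ | ⟨h0, h1, h2⟩
    · rw [h0, h1, h2]
    · rw [h0, h1, h2]
      field_simp
  have h2 : (-256 * M ^ 2 - x ^ 2) / (4 * x * r) ∈
      Set.range (algebraMap F (AlgebraicClosure F)) := by
    rw [InfiniteGalois.mem_range_algebraMap_iff_fixed]
    intro σ
    have h256 : σ (-256 * M ^ 2) = -256 * M ^ 2 := by
      rw [map_mul, map_neg, map_ofNat, map_pow, map_intCast]
    rw [map_div₀, map_mul, map_mul, map_ofNat, map_sub, h256, map_pow]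
    rcases key σ with ⟨h0, h1, h2⟩ | ⟨h0, h1, h2⟩
    · rw [h0, h1]
    · rw [h0, h1]
      field_simp
      ring
  obtain ⟨z, hz⟩ := h1
  obtain ⟨w, hw⟩ := h2
  refine ⟨z, w, (algebraMap F (AlgebraicClosure F)).injective ?_⟩
  simp only [map_add, map_sub, map_mul, map_pow, map_intCast, map_ofNat, hz, hw]
  rw [← hr]
  have e1 : r ^ 2 * (y / (2 * x * r)) ^ 2 = (x ^ 2 + 4 * u * M * x - 256 * M ^ 2) / (4 * x) := by
    rw [div_pow, e]; field_simp; ring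
  rw [e1]
  field_simp
  ring

variable {K : Type*} [Field K] [Algebra ℚ K] {u M : ℤ} {hM : M ≠ 0}

open Classical in
theorem some_add_pointT {L : Type*} [Field L] [Algebra ℚ L] {u M : ℤ} (hM : M ≠ 0) {x y : L}
    (h : ((curveA' u M).baseChange L).toAffine.Nonsingular x y) (hx : x ≠ 0) :
    ∃ h', (.some x y h + pointT hM : PointA' u M L) =
      .some (-256 * M ^ 2 / x) (256 * M ^ 2 * y / x ^ 2) h' := by
  have := algebraRat.charZero L
  have e := (equation_curveA'_iff u M x y).mp h.1
  have e1 : ((curveA' u M).baseChange L).toAffine.slope x 0 y 0 = y / x := by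
    rw [WeierstrassCurve.Affine.slope_of_X_ne hx]; simp
  have e2 : ((curveA' u M).baseChange L).toAffine.addX x 0
      (((curveA' u M).baseChange L).toAffine.slope x 0 y 0) = -256 * M ^ 2 / x := by
    rw [e1]
    simp [WeierstrassCurve.Affine.addX, curveA', WeierstrassCurve.baseChange]
    field_simp
    linear_combination e
  have e3 : ((curveA' u M).baseChange L).toAffine.addY x 0 y
      (((curveA' u M).baseChange L).toAffine.slope x 0 y 0) = 256 * M ^ 2 * y / x ^ 2 := by
    rw [WeierstrassCurve.Affine.addY, WeierstrassCurve.Affine.negAddY, e2, e1]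
    simp [WeierstrassCurve.Affine.negY, curveA', WeierstrassCurve.baseChange]
    field_simp
    ring
  rw [← e2, ← e3]
  exact ⟨_, WeierstrassCurve.Affine.Point.add_of_X_ne hx⟩

open Classical in
/-- The cocycle of `√d` is the coboundary of the point `(x, y)` at `σ`: either `σ` fixes `√d` and
`(x, y)`, or it moves `√d` and translates `(x, y)` by `(0, 0)`. -/
theorem galAct_sub_some_iff (d : ℚˣ) (σ : AlgebraicClosure K ≃ₐ[K] AlgebraicClosure K)
    {x y : AlgebraicClosure K}
    (h : ((curveA' u M).baseChange (AlgebraicClosure K)).toAffine.Nonsingular x y) (hx : x ≠ 0) :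
    (phiHat hM (galAct σ (.some x y h) - .some x y h) = 0 ∧
      (galAct σ (.some x y h) - .some x y h = (0 : PointA' u M (AlgebraicClosure K)) ↔
        FixesSqrt d σ)) ↔
    (FixesSqrt d σ ∧ σ x = x ∧ σ y = y) ∨
      (¬ FixesSqrt d σ ∧ σ x = -256 * M ^ 2 / x ∧ σ y = 256 * M ^ 2 * y / x ^ 2) := by
  have hT : (pointT hM : PointA' u M (AlgebraicClosure K)) ≠ 0 :=
    WeierstrassCurve.Affine.Point.some_ne_zero _
  obtain ⟨h', e'⟩ := some_add_pointT hM h hx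
  have e0 : galAct σ (.some x y h) - .some x y h = (0 : PointA' u M (AlgebraicClosure K)) ↔
      σ x = x ∧ σ y = y := by
    rw [sub_eq_zero, galAct]
    erw [WeierstrassCurve.Affine.Point.map_some]
    simp
  have e1 : galAct σ (.some x y h) - .some x y h =
      (pointT hM : PointA' u M (AlgebraicClosure K)) ↔
      σ x = -256 * M ^ 2 / x ∧ σ y = 256 * M ^ 2 * y / x ^ 2 := by
    rw [sub_eq_iff_eq_add, add_comm, e', galAct]
    erw [WeierstrassCurve.Affine.Point.map_some]
    simp
  rw [phiHat_eq_zero_iff, ← e0, ← e1]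
  by_cases hf : FixesSqrt d σ
  · simp only [hf, iff_true, true_and, not_true_eq_false, false_and, or_false]
    tauto
  · simp only [hf, iff_false, false_and, not_false_eq_true, true_and, false_or]
    constructor
    · tauto
    · intro h
      exact ⟨Or.inr h, h ▸ hT⟩

theorem algebraMap_rat_algebraicClosure (a : ℚ) : algebraMap ℚ (AlgebraicClosure K) a =
    algebraMap K (AlgebraicClosure K) (algebraMap ℚ K a) :=
  IsScalarTower.algebraMap_apply ℚ K (AlgebraicClosure K) a

theorem isSquare_of_forall_fixesSqrt {d : ℚˣ}
    (h : ∀ σ : AlgebraicClosure K ≃ₐ[K] AlgebraicClosure K, FixesSqrt d σ) :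
    IsSquare (algebraMap ℚ K d) := by
  have := algebraRat.charZero K
  obtain ⟨r, -, hr⟩ := exists_sqrt K d
  obtain ⟨s, rfl⟩ := (InfiniteGalois.mem_range_algebraMap_iff_fixed r).mpr fun σ => h σ r hr
  refine ⟨s, (algebraMap K (AlgebraicClosure K)).injective ?_⟩
  rw [← algebraMap_rat_algebraicClosure, ← hr, map_mul, sq]

theorem nonsingular_curveA' {L : Type*} [Field L] [Algebra ℚ L] {u M : ℤ} (hM : M ≠ 0) {x y : L}
    (h : ((curveA' u M).baseChange L).toAffine.Equation x y) :
    ((curveA' u M).baseChange L).toAffine.Nonsingular x y := by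
  refine (WeierstrassCurve.Affine.equation_iff_nonsingular_of_Δ_ne_zero ?_).mp h
  have h0 : (curveA' u M).Δ ≠ 0 := by
    have : (curveA' u M).Δ = 4096 * 4096 * (((u : ℚ) ^ 2 + 64) * (M : ℚ) ^ 6) := by
      simp only [WeierstrassCurve.Δ, WeierstrassCurve.b₂, WeierstrassCurve.b₄,
        WeierstrassCurve.b₆, WeierstrassCurve.b₈, curveA']
      ring
    have hM' : (M : ℚ) ≠ 0 := by exact_mod_cast hM
    rw [this]
    positivity
  have h1 : ((curveA' u M).baseChange L).Δ = algebraMap ℚ L (curveA' u M).Δ :=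
    WeierstrassCurve.map_Δ _ _
  exact h1 ▸ (map_ne_zero _).mpr h0

theorem IsTrivialOver.exists_torsor_point {d : ℚˣ} (h : IsTrivialOver u hM d K) :
    IsSquare (algebraMap ℚ K d) ∨
      ∃ z w : K, (algebraMap ℚ K d * z ^ 2 - u * M) ^ 2 + 64 * M ^ 2 =
        algebraMap ℚ K d * w ^ 2 := by
  classical
  obtain ⟨r, hr0, hr⟩ := exists_sqrt K d
  obtain ⟨P, hP⟩ := h
  match P, hP with
  | .zero, hP =>
    left
    refine isSquare_of_forall_fixesSqrt fun σ => (hP σ).2.mp ?_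
    rw [← WeierstrassCurve.Affine.Point.zero_def, map_zero, sub_zero]
  | .some x y h, hP =>
    have e := (equation_curveA'_iff u M x y).mp h.1
    by_cases hx : x = 0
    · left
      have hy : y = 0 := by simpa [hx] using e
      refine isSquare_of_forall_fixesSqrt fun σ => (hP σ).2.mp ?_
      rw [sub_eq_zero, galAct]
      erw [WeierstrassCurve.Affine.Point.map_some]
      simp [hx, hy]
    · right
      have := algebraRat.charZero K
      refine exists_torsor_point_of_forall_galois hr0
        (hr.trans (algebraMap_rat_algebraicClosure _)) hx e (fun σ => ?_) hM
      rcases (galAct_sub_some_iff (hM := hM) d σ h hx).mp (hP σ) with ⟨hf, h1⟩ | ⟨hf, h1⟩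
      · exact Or.inl ⟨(fixesSqrt_iff hr).mp hf, h1⟩
      · exact Or.inr ⟨(map_sqrt σ hr).resolve_left (mt (fixesSqrt_iff hr).mpr hf), h1⟩

theorem isTrivialOver_of_isSquare {d : ℚˣ} (h : IsSquare (algebraMap ℚ K d)) :
    IsTrivialOver u hM d K := by
  classical
  obtain ⟨s, hs⟩ := h
  refine ⟨0, fun σ => ?_⟩
  have : FixesSqrt d σ := by
    rw [fixesSqrt_iff (r := algebraMap K (AlgebraicClosure K) s) (by
      rw [sq, ← map_mul, ← hs, ← algebraMap_rat_algebraicClosure]), AlgEquiv.commutes]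
  simp [phiHat_eq_zero_iff, this]

/-- The two lifts of a point of the torsor to `A'`, for the two choices of `r = √d`, differ by
`(0, 0)`. -/
theorem lifted_point_formulas {L : Type*} [Field L] [CharZero L] {u M : ℤ} (hM : M ≠ 0)
    {r Z W x x' : L} (h : (r ^ 2 * Z ^ 2 - u * M) ^ 2 + 64 * M ^ 2 = r ^ 2 * W ^ 2)
    (hx : x = 2 * (r ^ 2 * Z ^ 2 - u * M - r * W))
    (hx' : x' = 2 * (r ^ 2 * Z ^ 2 - u * M + r * W)) :
    x ≠ 0 ∧ x' = -256 * M ^ 2 / x ∧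
      (2 * r * Z * x) ^ 2 = x ^ 3 + 4 * u * M * x ^ 2 - 256 * M ^ 2 * x := by
  have hM' : (M : L) ≠ 0 := by exact_mod_cast hM
  have hxx : x * x' = -256 * M ^ 2 := by
    rw [hx, hx']; linear_combination 4 * h
  have hx0 : x ≠ 0 := by
    rintro h
    rw [h, zero_mul, eq_comm] at hxx
    exact mul_ne_zero (by norm_num) (pow_ne_zero 2 hM') hxx
  refine ⟨hx0, by rw [eq_div_iff hx0, ← hxx]; ring, ?_⟩
  have : x + x' = 4 * (r ^ 2 * Z ^ 2 - u * M) := by rw [hx, hx']; ring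
  linear_combination (-x ^ 2) * this + x * hxx

/-- A rational point `(z, w)` of the torsor lifts to the point `(x, 2√d z x)` of `A'` with
`x = 2(d z² - uM - √d w)`. -/
theorem isTrivialOver_of_torsor_point {d : ℚˣ} {z w : K}
    (hzw : (algebraMap ℚ K d * z ^ 2 - u * M) ^ 2 + 64 * M ^ 2 = algebraMap ℚ K d * w ^ 2) :
    IsTrivialOver u hM d K := by
  obtain ⟨r, hr0, hr⟩ := exists_sqrt K d
  have hfix := fun σ => fixesSqrt_iff (σ := σ) hr
  have hmap := fun σ => map_sqrt σ hr
  have hneg : r ≠ -r := by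
    have := algebraRat.charZero (AlgebraicClosure K)
    exact fun h => hr0 (self_eq_neg.mp h)
  rw [algebraMap_rat_algebraicClosure] at hr
  obtain ⟨Z, hZ⟩ : ∃ Z, Z = algebraMap K (AlgebraicClosure K) z := ⟨_, rfl⟩
  obtain ⟨W, hW⟩ : ∃ W, W = algebraMap K (AlgebraicClosure K) w := ⟨_, rfl⟩
  have hzw' : (r ^ 2 * Z ^ 2 - u * M) ^ 2 + 64 * M ^ 2 = r ^ 2 * W ^ 2 := by
    have := congrArg (algebraMap K (AlgebraicClosure K)) hzw
    rw [map_add, map_pow, map_sub, map_mul, map_mul, map_mul, map_mul, map_pow, map_pow, map_pow,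
      map_intCast, map_intCast, map_ofNat, ← hr, ← hZ, ← hW] at this
    exact this
  obtain ⟨x, hxdef⟩ : ∃ x, x = 2 * (r ^ 2 * Z ^ 2 - u * M - r * W) := ⟨_, rfl⟩
  obtain ⟨x', hxdef'⟩ : ∃ x', x' = 2 * (r ^ 2 * Z ^ 2 - u * M + r * W) := ⟨_, rfl⟩
  obtain ⟨hx, hx', e⟩ : x ≠ 0 ∧ x' = -256 * M ^ 2 / x ∧
      (2 * r * Z * x) ^ 2 = x ^ 3 + 4 * u * M * x ^ 2 - 256 * M ^ 2 * x := by
    have := algebraRat.charZero (AlgebraicClosure K)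
    exact lifted_point_formulas hM hzw' hxdef hxdef'
  have h := nonsingular_curveA' hM ((equation_curveA'_iff u M _ _).mpr e)
  have hσx (σ : AlgebraicClosure K ≃ₐ[K] AlgebraicClosure K) :
      σ x = 2 * (σ r ^ 2 * Z ^ 2 - u * M - σ r * W) := by
    rw [hxdef, map_mul, map_sub, map_sub, map_mul, map_mul, map_mul, map_pow, map_pow, map_ofNat,
      map_intCast, map_intCast, hZ, hW, σ.commutes, σ.commutes]
  have hσy (σ : AlgebraicClosure K ≃ₐ[K] AlgebraicClosure K) :
      σ (2 * r * Z * x) = 2 * σ r * Z * σ x := by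
    rw [map_mul, map_mul, map_mul, map_ofNat, hZ, σ.commutes]
  refine ⟨.some x _ h, fun σ => (galAct_sub_some_iff d σ h hx).mpr ?_⟩
  rw [hfix σ, hσy]
  rcases hmap σ with hσ | hσ
  · have h1 : σ x = x := by rw [hσx, hσ, hxdef]
    exact Or.inl ⟨hσ, h1, by rw [h1, hσ]⟩
  · have h1 : σ x = x' := by rw [hσx, hσ, hxdef']; ring
    refine Or.inr ⟨by rw [hσ]; exact hneg.symm, h1.trans hx', ?_⟩
    rw [h1, hσ, hx']
    field_simp

/-- Triviality of the class of `d` in `H¹(K, A')` means that the torsor under `A'` attached to `d`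
has a `K`-rational point; a square `d` stands for the points at infinity. -/
theorem isTrivialOver_iff (d : ℚˣ) :
    IsTrivialOver u hM d K ↔ IsSquare (algebraMap ℚ K d) ∨
      ∃ z w : K, (algebraMap ℚ K d * z ^ 2 - u * M) ^ 2 + 64 * M ^ 2 =
        algebraMap ℚ K d * w ^ 2 :=
  ⟨fun h => h.exists_torsor_point, fun h => h.elim isTrivialOver_of_isSquare
    fun ⟨_, _, h⟩ => isTrivialOver_of_torsor_point h⟩

end Descent

/-! ### A quadratic character sum -/

section FiniteField

variable {F : Type*} [Field F] [Fintype F] [DecidableEq F]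

theorem sum_comp_sq_eq_sum_quadraticChar (hF : ringChar F ≠ 2) (g : F → ℤ) :
    ∑ x, g (x ^ 2) = ∑ s, (quadraticChar F s + 1) * g s := by
  rw [← Finset.sum_fiberwise (s := Finset.univ) (g := fun x : F => x ^ 2)]
  refine Finset.sum_congr rfl fun s _ => ?_
  rw [← quadraticChar_card_sqrts hF, Finset.sum_congr rfl (g := fun _ => g s), Finset.sum_const,
    nsmul_eq_mul]
  · congr 3
    ext; simp
  · intro x hx
    rw [(Finset.mem_filter.mp hx).2]

theorem sum_quadraticChar_sq_sub (hF : ringChar F ≠ 2) {D : F} (hD : D ≠ 0) :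
    ∑ x, quadraticChar F (x ^ 2 - D) = -1 := by
  rw [sum_comp_sq_eq_sum_quadraticChar hF (fun s => quadraticChar F (s - D))]
  simp only [add_mul, one_mul, Finset.sum_add_distrib]
  have h0 : ∑ s, quadraticChar F (s - D) = 0 :=
    ((Equiv.subRight D).sum_comp (fun s => quadraticChar F s)).trans (quadraticChar_sum_zero hF)
  have h1 : ∑ s, quadraticChar F s * quadraticChar F (s - D) =
      ∑ s, (quadraticChar F (1 - D * s) - if s = 0 then 1 else 0) := by
    rw [← Equiv.sum_comp (inv_involutive (G := F)).toPerm]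
    refine Finset.sum_congr rfl fun s _ => ?_
    rcases eq_or_ne s 0 with rfl | hs
    · simp
    · simp only [Function.Involutive.coe_toPerm, hs, if_false, sub_zero]
      rw [← map_mul, show s⁻¹ * (s⁻¹ - D) = (s⁻¹) ^ 2 * (1 - D * s) by field_simp, map_mul,
        quadraticChar_sq_one' (inv_ne_zero hs), one_mul]
  have h2 : ∑ s, quadraticChar F (1 - D * s) = 0 :=
    (((Equiv.mulLeft₀ D hD).trans (Equiv.subLeft 1)).sum_comp
      (fun s => quadraticChar F s)).trans (quadraticChar_sum_zero hF)
  rw [h0, h1, Finset.sum_sub_distrib, h2]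
  simp

/-- If `x² + a x + b` were a nonzero square for every nonsquare `x`, then
`∑ (1 - χ(x)) (1 - χ(x² + a x + b))` would reduce to the term at `x = 0`, which vanishes or is `1`
because `b` is a square. But the sum is at least `2`, since `∑ χ(x² + a x + b) = -1`. -/
theorem exists_nonsquare_quadratic_not_square (hF : ringChar F ≠ 2) {a b : F}
    (hD : a ^ 2 - 4 * b ≠ 0) (hb : IsSquare b) :
    ∃ x : F, ¬ IsSquare x ∧ (x ^ 2 + a * x + b = 0 ∨ ¬ IsSquare (x ^ 2 + a * x + b)) := by
  by_contra! H
  have h2 : (2 : F) ≠ 0 := Ring.two_ne_zero hF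
  have h4 : (4 : F) ≠ 0 := by
    rw [show (4 : F) = 2 * 2 by norm_num]; exact mul_ne_zero h2 h2
  set χ := quadraticChar F
  set f : F → F := fun x => x ^ 2 + a * x + b
  have hf : ∑ x, χ (f x) = -1 := by
    have hD' : (a ^ 2 - 4 * b) / 4 ≠ 0 := div_ne_zero hD h4
    rw [← sum_quadraticChar_sq_sub hF hD',
      ← Equiv.sum_comp (Equiv.addRight (a / 2)) (fun x => quadraticChar F (x ^ 2 - _))]
    refine Finset.sum_congr rfl fun x _ => congrArg χ ?_
    simp only [f, Equiv.coe_addRight]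
    field_simp
    ring
  have key (x : F) : (1 - χ x) * (1 - χ (f x)) = if x = 0 then 1 - χ b else 0 := by
    rcases eq_or_ne x 0 with rfl | hx
    · simp [f, χ]
    · rw [if_neg hx]
      by_cases hs : IsSquare x
      · rw [(quadraticChar_one_iff_isSquare hx).mpr hs]; simp
      · rw [(quadraticChar_one_iff_isSquare (H x hs).1).mpr (H x hs).2]; simp
  have hsum : ∑ x, (1 - χ x) * (1 - χ (f x)) = 1 - χ b := by
    simp only [key]; simp
  have hbd : -((Fintype.card F : ℤ) - 1) ≤ ∑ x, χ x * χ (f x) := by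
    have hle (x : F) : (if x = 0 then 1 else 0) - 1 ≤ χ x * χ (f x) := by
      rcases eq_or_ne x 0 with rfl | hx
      · simp [χ]
      · rw [if_neg hx, ← map_mul]
        by_cases h0 : x * f x = 0
        · simp [h0, χ]
        · rcases quadraticChar_dichotomy h0 with h | h <;> simp [χ, h]
    calc -((Fintype.card F : ℤ) - 1) = ∑ x : F, ((if x = 0 then 1 else 0) - 1 : ℤ) := by simp
      _ ≤ _ := Finset.sum_le_sum fun x _ => hle x
  have hexp : ∑ x, (1 - χ x) * (1 - χ (f x)) =
      Fintype.card F - ∑ x, χ x - ∑ x, χ (f x) + ∑ x, χ x * χ (f x) := by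
    simp only [sub_mul, mul_sub, one_mul, mul_one, Finset.sum_sub_distrib]
    simp
    ring
  rw [hsum, quadraticChar_sum_zero hF, hf] at hexp
  have hb' : 0 ≤ χ b := by
    rcases eq_or_ne b 0 with rfl | hb0
    · simp [χ]
    · rw [(quadraticChar_one_iff_isSquare hb0).mpr hb]; norm_num
  linarith

theorem isSquare_mul_of_not_isSquare {a b : F} (ha : ¬ IsSquare a)
    (hb : ¬ IsSquare b) : IsSquare (a * b) := by
  have ha0 : a ≠ 0 := by rintro rfl; exact ha IsSquare.zero
  have hb0 : b ≠ 0 := by rintro rfl; exact hb IsSquare.zero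
  rw [← quadraticChar_one_iff_isSquare (mul_ne_zero ha0 hb0), map_mul,
    quadraticChar_neg_one_iff_not_isSquare.mpr ha, quadraticChar_neg_one_iff_not_isSquare.mpr hb]
  norm_num

end FiniteField

/-! ### Applications of Hensel's lemma -/

section Padic

variable {q : ℕ} [Fact q.Prime]

theorem PadicInt.toZMod_eq_zero_iff_dvd (x : ℤ_[q]) : PadicInt.toZMod x = 0 ↔ (q : ℤ_[q]) ∣ x := by
  rw [← RingHom.mem_ker, PadicInt.ker_toZMod, PadicInt.maximalIdeal_eq_span_p,
    Ideal.mem_span_singleton]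

theorem PadicInt.exists_root_of_toZMod {f : Polynomial ℤ_[q]} {a : ℤ_[q]}
    (h0 : PadicInt.toZMod (f.eval a) = 0) (h1 : PadicInt.toZMod (f.derivative.eval a) ≠ 0) :
    ∃ z, f.eval z = 0 := by
  have h1' : ‖f.derivative.eval a‖ = 1 := by
    refine le_antisymm (PadicInt.norm_le_one _) (not_lt.mp fun h => h1 ?_)
    rwa [PadicInt.toZMod_eq_zero_iff_dvd, ← PadicInt.norm_lt_one_iff_dvd]
  rw [PadicInt.toZMod_eq_zero_iff_dvd, ← PadicInt.norm_lt_one_iff_dvd] at h0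
  obtain ⟨z, hz, -⟩ := hensels_lemma (F := f) (a := a) (by
    simpa only [Polynomial.coe_aeval_eq_eval, h1', one_pow] using h0)
  exact ⟨z, by simpa using hz⟩

theorem Padic.isSquare_intCast_of_zmod (hq : q ≠ 2) {n : ℤ} (hn : (n : ZMod q) ≠ 0)
    (h : IsSquare (n : ZMod q)) : IsSquare (n : ℚ_[q]) := by
  obtain ⟨s, hs⟩ := h
  obtain ⟨a, rfl⟩ := ZMod.ringHom_surjective PadicInt.toZMod s
  have h2 : (2 : ZMod q) ≠ 0 := Ring.two_ne_zero (by rwa [ZMod.ringChar_zmod_n])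
  obtain ⟨z, hz⟩ := PadicInt.exists_root_of_toZMod (q := q)
    (f := Polynomial.X ^ 2 - Polynomial.C (n : ℤ_[q])) (a := a) (by
      simp [hs, sq]) (by
      simp only [Polynomial.derivative_sub, Polynomial.derivative_X_pow, Polynomial.derivative_C]
      have : (PadicInt.toZMod a) ≠ 0 := by
        intro h; rw [h] at hs; simp at hs; exact hn hs
      simpa [map_ofNat] using ⟨h2, this⟩)
  refine ⟨z, ?_⟩
  have hz' : z ^ 2 - (n : ℤ_[q]) = 0 := by simpa using hz
  have := congrArg (fun t : ℤ_[q] => (t : ℚ_[q])) hz'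
  push_cast at this
  linear_combination -this

theorem Padic.isSquare_intCast_two {n : ℤ} (hn : n ≡ 1 [ZMOD 8]) : IsSquare (n : ℚ_[2]) := by
  have hd : (2 : ℤ) ^ 3 ∣ 1 - n := by simpa using hn.dvd
  have h1 : ‖((1 - n : ℤ) : ℤ_[2])‖ ≤ 1 / 8 := by
    have := (PadicInt.norm_int_le_pow_iff_dvd (p := 2) (k := 1 - n) (n := 3)).mpr (by simpa using hd)
    refine this.trans (by norm_num [zpow_neg])
  have h2 : ‖(2 : ℤ_[2])‖ = 1 / 2 := by
    have := PadicInt.norm_p (p := 2)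
    simpa using this
  obtain ⟨z, hz, -⟩ := hensels_lemma (p := 2)
    (F := Polynomial.X ^ 2 - Polynomial.C (n : ℤ_[2])) (a := 1) (by
      simp only [Polynomial.derivative_sub, Polynomial.derivative_X_pow, Polynomial.derivative_C]
      push_cast at h1
      simp [h2]
      exact h1.trans_lt (by norm_num))
  refine ⟨z, ?_⟩
  have hz' : z ^ 2 - (n : ℤ_[2]) = 0 := by simpa using hz
  have := congrArg (fun t : ℤ_[2] => (t : ℚ_[2])) hz'
  push_cast at this
  linear_combination -this

end Padic

/-! ### Local solubility: constructing points -/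

/-- The torsor under `A'^{(M)}` attached to the integer `d`, a smooth projective curve with affine
model `(d z² - uM)² + 64 M² = d w²`, has a `K`-rational point. Its two points at infinity are
rational if and only if `d` is a square. -/
def TorsorSoluble (u M d : ℤ) (K : Type*) [Field K] : Prop :=
  IsSquare (d : K) ∨
    ∃ z w : K, ((d : K) * z ^ 2 - u * M) ^ 2 + 64 * (M : K) ^ 2 = d * w ^ 2

theorem isTrivialOver_iff_torsorSoluble {K : Type*} [Field K] [Algebra ℚ K] {u M : ℤ} {hM : M ≠ 0}
    {x : ℚˣ} {d : ℤ} (hx : (x : ℚ) = d) : IsTrivialOver u hM x K ↔ TorsorSoluble u M d K := by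
  rw [isTrivialOver_iff, TorsorSoluble, hx, map_intCast]

theorem torsorSoluble_of_isSquare_mul {K : Type*} [Field K] {u M d : ℤ} (hd : (d : K) ≠ 0) {z : K}
    (h : IsSquare (((d * z ^ 2 - u * M) ^ 2 + 64 * (M : K) ^ 2) * d)) : TorsorSoluble u M d K := by
  obtain ⟨s, hs⟩ := h
  refine Or.inr ⟨z, s / d, ?_⟩
  field_simp
  linear_combination hs

theorem torsorSoluble_real_iff {u M d : ℤ} (hM : M ≠ 0) (hd : d ≠ 0) :
    TorsorSoluble u M d ℝ ↔ 0 < d := by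
  constructor
  · intro h
    by_contra hd'
    have hd0 : (d : ℝ) < 0 := by exact_mod_cast lt_of_le_of_ne (not_lt.mp hd') hd
    rcases h with ⟨s, hs⟩ | ⟨z, w, h⟩
    · nlinarith [mul_self_nonneg s]
    · have : (0 : ℝ) < 64 * (M : ℝ) ^ 2 := by
        have : (M : ℝ) ≠ 0 := by exact_mod_cast hM
        positivity
      linarith [sq_nonneg (d * z ^ 2 - u * M : ℝ),
        mul_nonpos_of_nonpos_of_nonneg hd0.le (sq_nonneg w)]
  · intro h
    have : (0 : ℝ) ≤ d := by exact_mod_cast h.le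
    exact Or.inl ⟨√d, (Real.mul_self_sqrt this).symm⟩

section Sufficiency

variable {q : ℕ} [Fact q.Prime] {u M d : ℤ}

theorem ZMod.two_ne_zero_of_ne_two (hq : q ≠ 2) : (2 : ZMod q) ≠ 0 :=
  Ring.two_ne_zero (by rwa [ZMod.ringChar_zmod_n])

/-- A nonzero root of `(d z² - uM)² + 64 M²` modulo `q` lifts to `ℚ_q`, since it is simple. -/
theorem exists_padic_root (hq : q ≠ 2) (hd : (d : ZMod q) ≠ 0) (hM : (M : ZMod q) ≠ 0)
    {z₀ : ZMod q} (hz₀ : z₀ ≠ 0)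
    (h : (d * z₀ ^ 2 - u * M) ^ 2 + 64 * (M : ZMod q) ^ 2 = 0) :
    ∃ z : ℚ_[q], (d * z ^ 2 - u * M) ^ 2 + 64 * (M : ℚ_[q]) ^ 2 = 0 := by
  have h2 := ZMod.two_ne_zero_of_ne_two hq
  obtain ⟨a, rfl⟩ := ZMod.ringHom_surjective PadicInt.toZMod z₀
  have hne : (d * PadicInt.toZMod a ^ 2 - u * M : ZMod q) ≠ 0 := by
    intro h0
    rw [h0] at h
    have : (2 : ZMod q) ^ 6 * (M : ZMod q) ^ 2 = 0 := by linear_combination h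
    simp [h2, hM] at this
  obtain ⟨z, hz⟩ := PadicInt.exists_root_of_toZMod (q := q)
    (f := (Polynomial.C (d : ℤ_[q]) * Polynomial.X ^ 2 - Polynomial.C ((u : ℤ_[q]) * M)) ^ 2 +
      Polynomial.C (64 * (M : ℤ_[q]) ^ 2)) (a := a) (by simpa [map_ofNat] using h) (by
      have : (2 : ZMod q) * (d * PadicInt.toZMod a ^ 2 - u * M) *
          (d * (2 * PadicInt.toZMod a)) ≠ 0 :=
        mul_ne_zero (mul_ne_zero h2 hne) (mul_ne_zero hd (mul_ne_zero h2 hz₀))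
      simpa [Polynomial.derivative_pow, map_ofNat] using this)
  refine ⟨z, ?_⟩
  have hz' : ((d : ℤ_[q]) * z ^ 2 - u * M) ^ 2 + 64 * (M : ℤ_[q]) ^ 2 = 0 := by simpa using hz
  have := congrArg (fun t : ℤ_[q] => (t : ℚ_[q])) hz'
  have h64 : ((64 : ℤ_[q]) : ℚ_[q]) = 64 := map_ofNat PadicInt.Coe.ringHom 64
  simpa [h64] using this

theorem intCast_padic_ne_zero (hd : (d : ZMod q) ≠ 0) : (d : ℚ_[q]) ≠ 0 := by
  intro h
  have : d = 0 := by exact_mod_cast h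
  exact hd (by simp [this])

theorem torsorSoluble_of_isSquare_zmod (hq : q ≠ 2) (hd : (d : ZMod q) ≠ 0) {z : ℤ}
    (h0 : ((d * z ^ 2 - u * M : ZMod q)) ^ 2 + 64 * (M : ZMod q) ^ 2 ≠ 0)
    (h : IsSquare ((((d * z ^ 2 - u * M : ZMod q)) ^ 2 + 64 * (M : ZMod q) ^ 2) * d)) :
    TorsorSoluble u M d ℚ_[q] := by
  refine torsorSoluble_of_isSquare_mul (z := z) (intCast_padic_ne_zero hd) ?_
  have := Padic.isSquare_intCast_of_zmod hq
    (n := ((d * z ^ 2 - u * M) ^ 2 + 64 * M ^ 2) * d) (by push_cast; exact mul_ne_zero h0 hd)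
    (by push_cast; exact h)
  exact_mod_cast this

/-- At an odd prime dividing neither `d` nor `M` the torsor is soluble. Unless `d` or `d (u² + 64)`
is a square, the character sum gives a point modulo `q`, over a nonsquare `d z²`, and it lifts. -/
theorem torsorSoluble_of_not_dvd (hq : q ≠ 2) (hd : (d : ZMod q) ≠ 0) (hM : (M : ZMod q) ≠ 0) :
    TorsorSoluble u M d ℚ_[q] := by
  have h2 := ZMod.two_ne_zero_of_ne_two hq
  have hF : ringChar (ZMod q) ≠ 2 := by rwa [ZMod.ringChar_zmod_n]
  by_cases hds : IsSquare (d : ZMod q)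
  · exact Or.inl (Padic.isSquare_intCast_of_zmod hq hd hds)
  by_cases hb : IsSquare (((u : ZMod q) ^ 2 + 64) * (M : ZMod q) ^ 2)
  · obtain ⟨x, hx, hfx⟩ := exists_nonsquare_quadratic_not_square hF
      (a := -2 * (u : ZMod q) * M) (b := ((u : ZMod q) ^ 2 + 64) * (M : ZMod q) ^ 2) (by
        rw [show (-2 * (u : ZMod q) * M) ^ 2 - 4 * (((u : ZMod q) ^ 2 + 64) * (M : ZMod q) ^ 2) =
          -(2 ^ 8 * (M : ZMod q) ^ 2) by ring]
        exact neg_ne_zero.mpr (mul_ne_zero (pow_ne_zero _ h2) (pow_ne_zero _ hM))) hb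
    have hx0 : x ≠ 0 := by rintro rfl; exact hx IsSquare.zero
    obtain ⟨s, hs⟩ := isSquare_mul_of_not_isSquare hx hds
    obtain ⟨z, hz⟩ := ZMod.intCast_surjective (s / (d : ZMod q))
    have hxz : (d : ZMod q) * (z : ZMod q) ^ 2 = x := by
      rw [hz]; field_simp; linear_combination -hs
    have hfz : (d * z ^ 2 - u * M : ZMod q) ^ 2 + 64 * (M : ZMod q) ^ 2 =
        x ^ 2 + -2 * (u : ZMod q) * M * x + ((u : ZMod q) ^ 2 + 64) * (M : ZMod q) ^ 2 := by
      rw [hxz]; ring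
    rcases eq_or_ne ((d * z ^ 2 - u * M : ZMod q) ^ 2 + 64 * (M : ZMod q) ^ 2) 0 with h0 | h0
    · have hz0 : (z : ZMod q) ≠ 0 := by
        intro h; rw [h] at hxz; simp at hxz; exact hx0 hxz.symm
      obtain ⟨t, ht⟩ := exists_padic_root hq hd hM hz0 h0
      exact Or.inr ⟨t, 0, by rw [ht]; simp⟩
    · exact torsorSoluble_of_isSquare_zmod hq hd h0
        (isSquare_mul_of_not_isSquare (by rw [hfz]; exact hfx.resolve_left (hfz ▸ h0)) hds)
  · have e : ((d * (0 : ℤ) ^ 2 - u * M : ZMod q)) ^ 2 + 64 * (M : ZMod q) ^ 2 =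
        ((u : ZMod q) ^ 2 + 64) * (M : ZMod q) ^ 2 := by push_cast; ring
    refine torsorSoluble_of_isSquare_zmod (z := 0) hq hd ?_ ?_
    · rw [e]; intro h; rw [h] at hb; exact hb IsSquare.zero
    · rw [e]; exact isSquare_mul_of_not_isSquare hb hds

/-- At an odd prime at which `d` is a unit, the torsor is soluble if `p = u² + 64` is not a
square: then `d` or `pd` is a square. -/
theorem torsorSoluble_of_not_isSquare (hq : q ≠ 2) (hd : (d : ZMod q) ≠ 0)
    (hp : ¬ IsSquare ((u ^ 2 + 64 : ℤ) : ZMod q)) : TorsorSoluble u M d ℚ_[q] := by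
  by_cases hds : IsSquare (d : ZMod q)
  · exact Or.inl (Padic.isSquare_intCast_of_zmod hq hd hds)
  have hp0 : ((u ^ 2 + 64 : ℤ) : ZMod q) ≠ 0 := by
    intro h; rw [h] at hp; exact hp IsSquare.zero
  obtain ⟨s, hs⟩ := Padic.isSquare_intCast_of_zmod hq (n := (u ^ 2 + 64) * d)
    (by rw [Int.cast_mul]; exact mul_ne_zero hp0 hd)
    (by rw [Int.cast_mul]; exact isSquare_mul_of_not_isSquare hp hds)
  refine torsorSoluble_of_isSquare_mul (z := 0) (intCast_padic_ne_zero hd) ⟨s * M, ?_⟩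
  push_cast at hs
  linear_combination (M : ℚ_[q]) ^ 2 * hs

/-- At an odd prime dividing both `d` and `M`, the torsor is soluble if
`(M / d) (u + 8 √-1)` is a square for a choice of `√-1`. -/
theorem torsorSoluble_of_dvd (hq : q ≠ 2) {m : ℤ} (hd : (d : ZMod q) ≠ 0) (hm : (m : ZMod q) ≠ 0)
    (hp : ((u ^ 2 + 64 : ℤ) : ZMod q) ≠ 0) {b : ZMod q} (hb : b ^ 2 = -1)
    (h : IsSquare ((m : ZMod q) * (u + 8 * b))) :
    TorsorSoluble u (q * (d * m)) (q * d) ℚ_[q] := by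
  obtain ⟨s, hs⟩ := h
  have hub : (u + 8 * b : ZMod q) ≠ 0 := by
    intro h0
    apply hp
    push_cast
    linear_combination (u - 8 * b) * h0 + 64 * hb
  have hs0 : s ≠ 0 := by
    rintro rfl
    rw [mul_zero] at hs
    exact mul_ne_zero hm hub hs
  obtain ⟨z, hz⟩ := exists_padic_root (u := u) (M := d * m) hq hd
    (by rw [Int.cast_mul]; exact mul_ne_zero hd hm) hs0 (by
      push_cast
      rw [sq s, ← hs]
      linear_combination (64 * (d : ZMod q) ^ 2 * m ^ 2) * hb)
  refine Or.inr ⟨z, 0, ?_⟩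
  push_cast at hz ⊢
  linear_combination (q : ℚ_[q]) ^ 2 * hz

theorem torsorSoluble_two_of_modEq_one (hd : d ≡ 1 [ZMOD 8]) : TorsorSoluble u M d ℚ_[2] :=
  Or.inl (Padic.isSquare_intCast_two hd)

/-- For `d ≡ 5` modulo `8` and `uM ≡ 1` modulo `4`, a point with `d z² = uM + 4` or
`d z² = uM + 16`. -/
theorem torsorSoluble_two_of_modEq_five (hd : d ≡ 5 [ZMOD 8]) (huM : u * M ≡ 1 [ZMOD 4]) :
    TorsorSoluble u M d ℚ_[2] := by
  have hd0 : (d : ℚ_[2]) ≠ 0 := by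
    have : d ≠ 0 := by rintro rfl; exact absurd hd (by decide)
    exact_mod_cast this
  have hMo : M % 2 = 1 := by
    rcases Int.emod_two_eq_zero_or_one M with h | h
    · obtain ⟨k, rfl⟩ := Int.dvd_of_emod_eq_zero h
      have : u * (2 * k) = 2 * (u * k) := by ring
      rw [this, Int.ModEq] at huM
      omega
    · exact h
  have hM2 : ∃ t, M ^ 2 = 8 * t + 1 := by
    obtain ⟨k, hk⟩ := Int.odd_iff.mpr hMo
    obtain ⟨j, hj⟩ := Int.even_mul_succ_self k
    exact ⟨j, by rw [hk]; linear_combination 4 * hj⟩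
  obtain ⟨t, ht⟩ := hM2
  obtain ⟨e, rfl⟩ : ∃ e, d = 8 * e + 5 := ⟨d / 8, by have := hd; rw [Int.ModEq] at this; omega⟩
  have main (k c : ℤ) (h1 : (u * M + k) * (8 * e + 5) ≡ 1 [ZMOD 8])
      (h2 : (8 * e + 5) * c ≡ 1 [ZMOD 8]) (r : ℤ) (h3 : k ^ 2 + 64 * M ^ 2 = r ^ 2 * c) :
      TorsorSoluble u M (8 * e + 5) ℚ_[2] := by
    obtain ⟨s, hs⟩ := Padic.isSquare_intCast_two h1
    obtain ⟨v, hv⟩ := Padic.isSquare_intCast_two h2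
    refine torsorSoluble_of_isSquare_mul (z := s / (8 * e + 5 : ℤ)) hd0 ⟨r * v, ?_⟩
    have hz : ((8 * e + 5 : ℤ) : ℚ_[2]) * (s / (8 * e + 5 : ℤ)) ^ 2 = u * M + k := by
      field_simp
      push_cast at hs ⊢
      linear_combination -hs
    rw [hz]
    have h3' : (k : ℚ_[2]) ^ 2 + 64 * M ^ 2 = r ^ 2 * c := by exact_mod_cast h3
    push_cast at hv ⊢
    linear_combination (8 * (e : ℚ_[2]) + 5) * h3' + (r : ℚ_[2]) ^ 2 * hv
  have h8 : u * M % 8 = 1 ∨ u * M % 8 = 5 := by rw [Int.ModEq] at huM; omega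
  rcases h8 with h8 | h8
  · obtain ⟨j, hj⟩ : ∃ j, u * M = 8 * j + 1 := ⟨u * M / 8, by omega⟩
    refine main 4 (1 + 4 * M ^ 2) ?_ ?_ 4 (by ring)
    · rw [hj]; exact (Int.modEq_iff_dvd.mpr ⟨-(8 * j * e + 5 * j + 5 * e + 3), by ring⟩)
    · rw [ht]; exact (Int.modEq_iff_dvd.mpr ⟨-(32 * t * e + 20 * t + 5 * e + 3), by ring⟩)
  · obtain ⟨j, hj⟩ : ∃ j, u * M = 8 * j + 5 := ⟨u * M / 8, by omega⟩
    refine main 16 (4 + M ^ 2) ?_ ?_ 8 (by ring)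
    · rw [hj]; exact (Int.modEq_iff_dvd.mpr ⟨-(8 * j * e + 5 * j + 21 * e + 13), by ring⟩)
    · rw [ht]; exact (Int.modEq_iff_dvd.mpr ⟨-(8 * t * e + 5 * t + 5 * e + 3), by ring⟩)

end Sufficiency

/-! ### Local obstructions -/

section Necessity

variable {q : ℕ} [Fact q.Prime] {u M d : ℤ}

theorem PadicInt.intCast_dvd_iff (n : ℤ) : (q : ℤ_[q]) ∣ n ↔ (q : ℤ) ∣ n := by
  simpa using PadicInt.pow_p_dvd_int_iff (p := q) 1 n

theorem Padic.norm_le_one_of_norm_mul_sq_le_one (hd : ¬ (q : ℤ) ^ 2 ∣ d) {w : ℚ_[q]}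
    (h : ‖(d : ℚ_[q]) * w ^ 2‖ ≤ 1) : ‖w‖ ≤ 1 := by
  by_contra! hw
  have hw0 : w ≠ 0 := by rintro rfl; simp at hw; linarith
  have hw1 : ‖w⁻¹‖ < 1 := by rw [norm_inv]; exact inv_lt_one_of_one_lt₀ hw
  obtain ⟨t, ht⟩ := (PadicInt.norm_lt_one_iff_dvd (⟨w⁻¹, hw1.le⟩ : ℤ_[q])).mp hw1
  have ht' : w⁻¹ = q * (t : ℚ_[q]) := congrArg (fun s : ℤ_[q] => (s : ℚ_[q])) ht
  apply hd
  obtain ⟨v, hv⟩ : ∃ v : ℤ_[q], (v : ℚ_[q]) = d * w ^ 2 := ⟨⟨_, h⟩, rfl⟩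
  have : (q : ℤ_[q]) ^ 2 ∣ d := by
    refine ⟨t ^ 2 * v, PadicInt.ext ?_⟩
    push_cast
    rw [hv, ← mul_assoc, ← mul_pow, ← ht']
    field_simp
  exact (PadicInt.pow_p_dvd_int_iff 2 d).mp this

/-- A `q`-adic point of the torsor, possibly at infinity, in primitive homogeneous integral
coordinates. -/
theorem TorsorSoluble.exists_padicInt (hd : ¬ (q : ℤ) ^ 2 ∣ d) (h : TorsorSoluble u M d ℚ_[q]) :
    ∃ a c w : ℤ_[q], ¬ ((q : ℤ_[q]) ∣ a ∧ (q : ℤ_[q]) ∣ c) ∧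
      (d * a ^ 2 - u * M * c ^ 2) ^ 2 + 64 * M ^ 2 * c ^ 4 = d * w ^ 2 := by
  have h64 : ((64 : ℤ_[q]) : ℚ_[q]) = 64 := map_ofNat PadicInt.Coe.ringHom 64
  have hq1 : ¬ (q : ℤ_[q]) ∣ 1 := PadicInt.prime_p.not_dvd_one
  -- it suffices to find coordinates with `a`, `c` integral
  have main (a c : ℤ_[q]) (w : ℚ_[q]) (hac : ¬ ((q : ℤ_[q]) ∣ a ∧ (q : ℤ_[q]) ∣ c))
      (e : (d * a ^ 2 - u * M * c ^ 2) ^ 2 + 64 * (M : ℚ_[q]) ^ 2 * c ^ 4 = d * w ^ 2) :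
      ∃ a c w : ℤ_[q], ¬ ((q : ℤ_[q]) ∣ a ∧ (q : ℤ_[q]) ∣ c) ∧
        (d * a ^ 2 - u * M * c ^ 2) ^ 2 + 64 * M ^ 2 * c ^ 4 = d * w ^ 2 := by
    have e' : (((d * a ^ 2 - u * M * c ^ 2) ^ 2 + 64 * M ^ 2 * c ^ 4 : ℤ_[q]) : ℚ_[q]) =
        d * w ^ 2 := by rw [← e]; simp [h64]
    have hw : ‖w‖ ≤ 1 := Padic.norm_le_one_of_norm_mul_sq_le_one hd (by
      rw [← e']; exact PadicInt.norm_le_one _)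
    obtain ⟨w, rfl⟩ : ∃ v : ℤ_[q], (v : ℚ_[q]) = w := ⟨⟨_, hw⟩, rfl⟩
    refine ⟨a, c, w, hac, PadicInt.ext ?_⟩
    rw [e']
    simp
  rcases h with ⟨s, hs⟩ | ⟨z, w, h⟩
  · refine main 1 0 s (fun h => hq1 h.1) ?_
    push_cast
    linear_combination (d : ℚ_[q]) * hs
  · rcases le_or_gt ‖z‖ 1 with hz | hz
    · refine main ⟨z, hz⟩ 1 w (fun h => hq1 h.2) ?_
      push_cast
      linear_combination h
    · have hz0 : z ≠ 0 := by rintro rfl; simp at hz; linarith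
      have hz1 : ‖z⁻¹‖ < 1 := by rw [norm_inv]; exact inv_lt_one_of_one_lt₀ hz
      refine main 1 ⟨z⁻¹, hz1.le⟩ (w * z⁻¹ ^ 2) (fun h => hq1 h.1) ?_
      push_cast
      have hz' : z * z⁻¹ = 1 := mul_inv_cancel₀ hz0
      rw [show (d : ℚ_[q]) * 1 ^ 2 = d * (z * z⁻¹) ^ 2 by rw [hz']]
      linear_combination (z⁻¹) ^ 4 * h

/-- At a prime not dividing `pM` the Selmer classes have even valuation. -/
theorem TorsorSoluble.not_dvd (hd : ¬ (q : ℤ) ^ 2 ∣ d) (hM : ¬ (q : ℤ) ∣ M)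
    (hp : ¬ (q : ℤ) ∣ u ^ 2 + 64) (h : TorsorSoluble u M d ℚ_[q]) : ¬ (q : ℤ) ∣ d := by
  rintro ⟨d', rfl⟩
  have hπ := PadicInt.prime_p (p := q)
  have hd' : ¬ (q : ℤ_[q]) ∣ d' := by
    rw [PadicInt.intCast_dvd_iff]
    exact fun h => hd (by rw [sq]; exact mul_dvd_mul_left _ h)
  have hpM : ¬ (q : ℤ_[q]) ∣ ((u : ℤ_[q]) ^ 2 + 64) * M ^ 2 := by
    intro h
    rcases hπ.dvd_or_dvd h with h | h
    · exact hp ((PadicInt.intCast_dvd_iff _).mp (by push_cast; exact h))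
    · exact hM ((PadicInt.intCast_dvd_iff _).mp (hπ.dvd_of_dvd_pow h))
  obtain ⟨a, c, w, hac, e⟩ := h.exists_padicInt hd
  push_cast at e
  have hc : (q : ℤ_[q]) ∣ c := by
    have : (q : ℤ_[q]) ∣ ((u : ℤ_[q]) ^ 2 + 64) * M ^ 2 * c ^ 4 :=
      ⟨d' * w ^ 2 - (q * d' ^ 2 * a ^ 4 - 2 * u * M * d' * a ^ 2 * c ^ 2), by
        linear_combination e⟩
    exact hπ.dvd_of_dvd_pow ((hπ.dvd_or_dvd this).resolve_left hpM)
  obtain ⟨c, rfl⟩ := hc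
  have hq0 : (q : ℤ_[q]) ≠ 0 := hπ.ne_zero
  have e1 : q * (d' ^ 2 * a ^ 4 - 2 * u * M * q * d' * a ^ 2 * c ^ 2 +
      q ^ 2 * ((u ^ 2 + 64) * M ^ 2) * c ^ 4) = d' * w ^ 2 :=
    mul_left_cancel₀ hq0 (by linear_combination e)
  have hw : (q : ℤ_[q]) ∣ w :=
    hπ.dvd_of_dvd_pow ((hπ.dvd_or_dvd (Dvd.intro _ e1)).resolve_left hd')
  obtain ⟨w, rfl⟩ := hw
  have e2 : d' ^ 2 * a ^ 4 - 2 * u * M * q * d' * a ^ 2 * c ^ 2 +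
      q ^ 2 * ((u ^ 2 + 64) * M ^ 2) * c ^ 4 = q * (d' * w ^ 2) :=
    mul_left_cancel₀ hq0 (by linear_combination e1)
  have : (q : ℤ_[q]) ∣ (d' : ℤ_[q]) ^ 2 * a ^ 4 :=
    ⟨d' * w ^ 2 + 2 * u * M * d' * a ^ 2 * c ^ 2 - q * ((u ^ 2 + 64) * M ^ 2) * c ^ 4, by
      linear_combination e2⟩
  rcases hπ.dvd_or_dvd this with h | h
  · exact hd' (hπ.dvd_of_dvd_pow h)
  · exact hac ⟨hπ.dvd_of_dvd_pow h, Dvd.intro _ rfl⟩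

theorem isSquare_of_sq_mul_eq_mul_sq {F : Type*} [Field F] {d y k w : F} (hk : IsSquare k)
    (hy : y ≠ 0) (hk0 : k ≠ 0) (h : k * y ^ 2 = d * w ^ 2) : IsSquare d := by
  obtain ⟨s, rfl⟩ := hk
  have hw : w ≠ 0 := by
    rintro rfl
    rw [zero_pow two_ne_zero, mul_zero] at h
    exact mul_ne_zero hk0 (pow_ne_zero 2 hy) h
  refine ⟨s * y / w, ?_⟩
  field_simp
  linear_combination -h

/-- At a prime dividing `M` exactly once, modulo which `p` is a square, the Selmer classes of even
valuation are locally trivial. -/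
theorem TorsorSoluble.isSquare_zmod {M' : ℤ} (hd : (d : ZMod q) ≠ 0)
    (hM' : (M' : ZMod q) ≠ 0) (hp0 : ((u ^ 2 + 64 : ℤ) : ZMod q) ≠ 0)
    (hp : IsSquare ((u ^ 2 + 64 : ℤ) : ZMod q))
    (h : TorsorSoluble u (q * M') d ℚ_[q]) : IsSquare (d : ZMod q) := by
  have hπ := PadicInt.prime_p (p := q)
  have hq0 : (q : ℤ_[q]) ≠ 0 := hπ.ne_zero
  have hd' : ¬ (q : ℤ) ∣ d := by rwa [← ZMod.intCast_zmod_eq_zero_iff_dvd]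
  obtain ⟨a, c, w, hac, e⟩ := h.exists_padicInt
    (fun h => hd' ((dvd_pow_self _ two_ne_zero).trans h))
  push_cast at e
  by_cases ha : (q : ℤ_[q]) ∣ a
  · have hc : PadicInt.toZMod c ≠ 0 := by
      rw [Ne, PadicInt.toZMod_eq_zero_iff_dvd]; exact fun h => hac ⟨ha, h⟩
    obtain ⟨a, rfl⟩ := ha
    have hw : (q : ℤ_[q]) ∣ w := by
      have : (q : ℤ_[q]) ∣ d * w ^ 2 := by
        rw [← e]
        exact ⟨q * ((d * q * a ^ 2 - u * M' * c ^ 2) ^ 2 + 64 * M' ^ 2 * c ^ 4), by ring⟩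
      exact hπ.dvd_of_dvd_pow ((hπ.dvd_or_dvd this).resolve_left
        (by rwa [PadicInt.intCast_dvd_iff]))
    obtain ⟨w, rfl⟩ := hw
    have e1 : (d * q * a ^ 2 - u * M' * c ^ 2) ^ 2 + 64 * M' ^ 2 * c ^ 4 = d * w ^ 2 :=
      mul_left_cancel₀ (pow_ne_zero 2 hq0) (by linear_combination e)
    have e2 := congrArg PadicInt.toZMod e1
    simp only [map_add, map_sub, map_mul, map_pow, map_intCast, map_natCast, map_ofNat,
      CharP.cast_eq_zero] at e2
    refine isSquare_of_sq_mul_eq_mul_sq hp (mul_ne_zero hM' (pow_ne_zero 2 hc)) hp0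
      (w := PadicInt.toZMod w) ?_
    push_cast
    linear_combination e2
  · have ha' : PadicInt.toZMod a ≠ 0 := by rwa [Ne, PadicInt.toZMod_eq_zero_iff_dvd]
    have e2 := congrArg PadicInt.toZMod e
    simp only [map_add, map_sub, map_mul, map_pow, map_intCast, map_natCast, map_ofNat,
      CharP.cast_eq_zero] at e2
    refine isSquare_of_sq_mul_eq_mul_sq IsSquare.one (mul_ne_zero hd (pow_ne_zero 2 ha'))
      one_ne_zero (w := PadicInt.toZMod w) ?_
    linear_combination e2

/-- At an odd prime dividing `M` and `d` exactly once, solubility forces `-1` to be a square and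
`(M / d) (u + 8 √-1)` to be a square for some choice of `√-1`. -/
theorem TorsorSoluble.exists_sq_eq_neg_one (hq : q ≠ 2) {M' d' : ℤ} (hd : (d' : ZMod q) ≠ 0)
    (hM' : (M' : ZMod q) ≠ 0) (h : TorsorSoluble u (q * M') (q * d') ℚ_[q]) :
    ∃ b : ZMod q, b ^ 2 = -1 ∧ IsSquare ((M' : ZMod q) * d' * (u + 8 * b)) := by
  have hπ := PadicInt.prime_p (p := q)
  have hq0 : (q : ℤ_[q]) ≠ 0 := hπ.ne_zero
  have hd' : ¬ (q : ℤ) ∣ d' := by rwa [← ZMod.intCast_zmod_eq_zero_iff_dvd]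
  have h2 := ZMod.two_ne_zero_of_ne_two hq
  obtain ⟨a, c, w, hac, e⟩ := h.exists_padicInt (fun h => hd' (by
    rw [sq] at h
    exact (mul_dvd_mul_iff_left (by exact_mod_cast (Fact.out : q.Prime).ne_zero)).mp h))
  push_cast at e
  have hw : (q : ℤ_[q]) ∣ w := by
    have e1 : (q : ℤ_[q]) * ((d' * a ^ 2 - u * M' * c ^ 2) ^ 2 + 64 * M' ^ 2 * c ^ 4) =
        d' * w ^ 2 := mul_left_cancel₀ hq0 (by linear_combination e)
    exact hπ.dvd_of_dvd_pow ((hπ.dvd_or_dvd (Dvd.intro _ e1)).resolve_left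
      (by rwa [PadicInt.intCast_dvd_iff]))
  obtain ⟨w, rfl⟩ := hw
  have e1 : (d' * a ^ 2 - u * M' * c ^ 2) ^ 2 + 64 * M' ^ 2 * c ^ 4 = q * (d' * w ^ 2) :=
    mul_left_cancel₀ (pow_ne_zero 2 hq0) (by linear_combination e)
  have e2 := congrArg PadicInt.toZMod e1
  simp only [map_add, map_sub, map_mul, map_pow, map_intCast, map_natCast, map_ofNat,
    CharP.cast_eq_zero, zero_mul] at e2
  rw [← PadicInt.toZMod_eq_zero_iff_dvd, ← PadicInt.toZMod_eq_zero_iff_dvd] at hac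
  generalize PadicInt.toZMod a = a at *
  generalize PadicInt.toZMod c = c at *
  have hc : c ≠ 0 := by
    rintro rfl
    refine hac ⟨?_, rfl⟩
    have : (d' : ZMod q) ^ 2 * a ^ 4 = 0 := by linear_combination e2
    simpa [hd] using this
  have h8 : (8 : ZMod q) ≠ 0 := by
    rw [show (8 : ZMod q) = 2 ^ 3 by norm_num]; exact pow_ne_zero _ h2
  refine ⟨(d' * a ^ 2 - u * M' * c ^ 2) / (8 * M' * c ^ 2), ?_, ⟨d' * a / c, ?_⟩⟩
  · field_simp
    linear_combination e2
  · field_simp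
    ring

theorem not_mul_sq_modEq_one (hd : d ≡ 5 [ZMOD 8]) (w : ℤ) : ¬ d * w ^ 2 ≡ 1 [ZMOD 8] := by
  intro h
  have hd' := (ZMod.intCast_eq_intCast_iff _ _ 8).mpr hd
  have h' := (ZMod.intCast_eq_intCast_iff _ _ 8).mpr h
  push_cast at hd' h'
  rw [hd'] at h'
  clear hd' h
  generalize (w : ZMod 8) = w at h'
  revert w
  decide

/-- If `d a² - m c²` is odd, the equation modulo `8` reads `d w² ≡ 1`; otherwise `a` and `c` are
odd, `d a² - m c² ≡ 2` modulo `4`, and `w = 2v` with `d v² ≡ 1` modulo `8`. -/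
theorem not_dvd_thirtytwo (hd : d ≡ 5 [ZMOD 8]) {m : ℤ} (hm : m ≡ 3 [ZMOD 4]) {a c w k : ℤ}
    (hac : ¬ (2 ∣ a ∧ 2 ∣ c)) :
    ¬ (32 : ℤ) ∣ (d * a ^ 2 - m * c ^ 2) ^ 2 + 64 * k - d * w ^ 2 := by
  rintro ⟨j, hj⟩
  have hd2 : Odd d := Int.odd_iff.mpr (by rw [Int.ModEq] at hd; omega)
  have hm2 : Odd m := Int.odd_iff.mpr (by rw [Int.ModEq] at hm; omega)
  have hodd (x : ℤ) (hx : Odd x) : ∃ y, x ^ 2 = 8 * y + 1 := by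
    obtain ⟨k, rfl⟩ := hx
    obtain ⟨j, hj⟩ := Int.even_mul_succ_self k
    exact ⟨j, by linear_combination 4 * hj⟩
  rcases Int.even_or_odd (d * a ^ 2 - m * c ^ 2) with h | h
  · have hac' : Odd a ∧ Odd c := by
      rw [← even_iff_two_dvd, ← even_iff_two_dvd] at hac
      rw [← Int.not_even_iff_odd] at hd2 hm2 ⊢
      rw [← Int.not_even_iff_odd]
      simp only [Int.even_sub, Int.even_mul, Int.even_pow, hd2, hm2, false_or] at h
      tauto
    obtain ⟨x, hx⟩ := hodd a hac'.1
    obtain ⟨y, hy⟩ := hodd c hac'.2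
    obtain ⟨e, rfl⟩ : ∃ e, d = 8 * e + 5 := ⟨d / 8, by rw [Int.ModEq] at hd; omega⟩
    obtain ⟨n, rfl⟩ : ∃ n, m = 4 * n + 3 := ⟨m / 4, by rw [Int.ModEq] at hm; omega⟩
    obtain ⟨l, hl⟩ : ∃ l, (8 * e + 5) * a ^ 2 - (4 * n + 3) * c ^ 2 = 4 * l + 2 :=
      ⟨16 * e * x + 2 * e + 10 * x - 8 * n * y - n - 6 * y, by rw [hx, hy]; ring⟩
    obtain ⟨r, hr⟩ := Int.even_mul_succ_self l
    rw [hl] at hj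
    have hw : Even w := by
      have h4 : Even ((8 * e + 5) * w ^ 2) :=
        ⟨8 * (l ^ 2 + l) + 2 + 32 * k - 16 * j, by linear_combination -hj⟩
      rcases Int.even_mul.mp h4 with h4 | h4
      · exact absurd h4 (Int.not_even_iff_odd.mpr hd2)
      · exact (Int.even_pow.mp h4).1
    obtain ⟨v, rfl⟩ := hw
    refine not_mul_sq_modEq_one hd v (Int.modEq_iff_dvd.mpr ⟨j - r - 2 * k, ?_⟩)
    have h4 : 4 * (1 - (8 * e + 5) * v ^ 2) = 4 * (8 * (j - r - 2 * k)) := by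
      linear_combination hj - 16 * hr
    linarith
  · obtain ⟨x, hx⟩ := hodd _ h
    refine not_mul_sq_modEq_one hd w (Int.modEq_iff_dvd.mpr ⟨4 * j - x - 8 * k, ?_⟩)
    linear_combination hj - hx

/-- No `2`-adic point in the case `M ≡ 3` modulo `4`, `d ≡ 5` modulo `8`: there is none
modulo `32`. -/
theorem not_torsorSoluble_two (hd : d ≡ 5 [ZMOD 8]) (hu : u ≡ 1 [ZMOD 4])
    (hM : M ≡ 3 [ZMOD 4]) : ¬ TorsorSoluble u M d ℚ_[2] := by
  intro h
  obtain ⟨a, c, w, hac, e⟩ := h.exists_padicInt (q := 2) (by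
    intro h; have := hd; rw [Int.ModEq] at this; norm_num at h; omega)
  have e32 := congrArg (PadicInt.toZModPow 5) e
  simp only [map_add, map_sub, map_mul, map_pow, map_intCast, map_ofNat] at e32
  have approx (x : ℤ_[2]) :
      ∃ n : ℤ, PadicInt.toZModPow 5 x = n ∧ ((2 : ℤ) ∣ n → (2 : ℤ_[2]) ∣ x) := by
    obtain ⟨n, hn⟩ := ZMod.intCast_surjective (PadicInt.toZModPow 5 x)
    refine ⟨n, hn.symm, fun ⟨k, hk⟩ => ?_⟩
    have : x - n ∈ RingHom.ker (PadicInt.toZModPow (p := 2) 5) := by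
      rw [RingHom.mem_ker, map_sub, map_intCast, hn, sub_self]
    rw [PadicInt.ker_toZModPow, Ideal.mem_span_singleton] at this
    obtain ⟨y, hy⟩ := this
    refine ⟨k + 2 ^ 4 * y, ?_⟩
    have hk' : (n : ℤ_[2]) = 2 * k := by rw [hk]; push_cast; ring
    push_cast at hy
    linear_combination hy + hk'
  obtain ⟨a', ha', ha⟩ := approx a
  obtain ⟨c', hc', hc⟩ := approx c
  obtain ⟨w', hw', -⟩ := approx w
  rw [ha', hc', hw'] at e32
  refine not_dvd_thirtytwo hd (m := u * M) (a := a') (c := c') (w := w') (k := M ^ 2 * c' ^ 4)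
    (by simpa using hu.mul hM) (fun h => hac ⟨by simpa using ha h.1, by simpa using hc h.2⟩) ?_
  have := (ZMod.intCast_zmod_eq_zero_iff_dvd
    ((d * a' ^ 2 - u * M * c' ^ 2) ^ 2 + 64 * (M ^ 2 * c' ^ 4) - d * w' ^ 2) (2 ^ 5)).mp (by
      push_cast
      linear_combination e32)
  simpa using this

end Necessity

/-! ### Splitting of primes in `ℚ(√p)` -/

section Splitting

open scoped Pointwise

theorem intCast_mem_iff_of_liesOver {S : Type*} [CommRing S] {q : ℕ} {P : Ideal S}
    [P.LiesOver (Ideal.span {(q : ℤ)})] (n : ℤ) : (n : S) ∈ P ↔ (q : ℤ) ∣ n := by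
  rw [← Ideal.mem_span_singleton, Ideal.mem_of_liesOver P (Ideal.span {(q : ℤ)})]
  simp

/-- In a quadratic field containing an integral square root `θ` of `n`, an odd prime `q` not
dividing `n` splits if and only if `n` is a square modulo `q`. -/
theorem ncard_primesOver_eq_two_iff {K : Type*} [Field K] [NumberField K]
    [Algebra.IsQuadraticExtension ℚ K] {n : ℤ} {θ : 𝓞 K} (hθ : θ ^ 2 = n)
    (hθK : (θ : K) ∉ Set.range (algebraMap ℚ K)) {q : ℕ} [Fact q.Prime] (hq : q ≠ 2)
    (hn : (n : ZMod q) ≠ 0) :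
    ((Ideal.span {(q : ℤ)}).primesOver (𝓞 K)).ncard = 2 ↔ IsSquare (n : ZMod q) := by
  have hprime : (Ideal.span {(q : ℤ)}).IsPrime := inferInstance
  have hcard := Ideal.ncard_primesOver_mul_ramificationIdxIn_mul_inertiaDegIn
    (Ideal.span {(q : ℤ)}) (𝓞 K) (K ≃ₐ[ℚ] K)
  rw [IsGalois.card_aut_eq_finrank, Algebra.IsQuadraticExtension.finrank_eq_two] at hcard
  obtain ⟨⟨P, hP, hPq⟩⟩ :=
    (inferInstance : Nonempty ((Ideal.span {(q : ℤ)}).primesOver (𝓞 K)))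
  constructor
  · intro h
    have hf : P.inertiaDeg ℤ = 1 := by
      rw [← Ideal.inertiaDegIn_eq_inertiaDeg (Ideal.span {(q : ℤ)}) P (K ≃ₐ[ℚ] K)]
      rw [h] at hcard
      exact Nat.eq_one_of_mul_eq_one_left (Nat.eq_of_mul_eq_mul_left two_pos hcard)
    have hPm : P.IsMaximal := Ideal.IsMaximal.of_liesOver_isMaximal P (Ideal.span {(q : ℤ)})
    rw [Ideal.inertiaDeg_eq_of_isMaximal (Ideal.span {(q : ℤ)})] at hf
    let _ := Ideal.Quotient.field (Ideal.span {(q : ℤ)})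
    obtain ⟨c, hc⟩ := (finrank_eq_one_iff_of_nonzero' (1 : 𝓞 K ⧸ P) one_ne_zero).mp hf
      (Ideal.Quotient.mk P θ)
    obtain ⟨c, rfl⟩ := Ideal.Quotient.mk_surjective c
    have hc' : Ideal.Quotient.mk P ((c : 𝓞 K) - θ) = 0 := by
      rw [map_sub, ← hc, sub_eq_zero, Algebra.smul_def, mul_one]
      simp
    rw [Ideal.Quotient.eq_zero_iff_mem] at hc'
    have hmem : ((c ^ 2 - n : ℤ) : 𝓞 K) ∈ P := by
      push_cast
      rw [← hθ, sq_sub_sq]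
      exact P.mul_mem_left _ hc'
    rw [intCast_mem_iff_of_liesOver (q := q), ← ZMod.intCast_zmod_eq_zero_iff_dvd] at hmem
    push_cast at hmem
    exact ⟨c, by linear_combination -hmem⟩
  · rintro ⟨s, hs⟩
    obtain ⟨a, rfl⟩ := ZMod.intCast_surjective s
    obtain ⟨σ, hσ⟩ : ∃ σ : K ≃ₐ[ℚ] K, σ θ ≠ θ := by
      by_contra! h
      exact hθK ((IsGalois.mem_range_algebraMap_iff_fixed (F := ℚ) (θ : K)).mpr h)
    have hint (k : ℤ) : σ • (k : 𝓞 K) = k :=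
      map_intCast (MulSemiringAction.toRingHom (K ≃ₐ[ℚ] K) (𝓞 K) σ) k
    have hσθ : σ • θ = -θ := by
      have h1 : (σ • θ) ^ 2 = θ ^ 2 := by rw [← smul_pow', hθ, hint]
      refine (sq_eq_sq_iff_eq_or_eq_neg.mp h1).resolve_left fun h => hσ ?_
      exact congrArg (fun t : 𝓞 K => (t : K)) h
    by_contra hne
    have h1 : ((Ideal.span {(q : ℤ)}).primesOver (𝓞 K)).ncard = 1 := by
      rcases (Nat.dvd_prime Nat.prime_two).mp (Dvd.intro _ hcard) with h | h
      · exact h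
      · exact absurd h hne
    obtain ⟨Q, hQ⟩ := Set.ncard_eq_one.mp h1
    have hPQ : P = Q := by
      have : P ∈ (Ideal.span {(q : ℤ)}).primesOver (𝓞 K) := ⟨hP, hPq⟩
      rwa [hQ, Set.mem_singleton_iff] at this
    have hσP : σ • P = P := by
      have : σ • P ∈ (Ideal.span {(q : ℤ)}).primesOver (𝓞 K) := ⟨inferInstance, inferInstance⟩
      rwa [hQ, Set.mem_singleton_iff, ← hPQ] at this
    have hstab (x : 𝓞 K) (hx : x ∈ P) : σ • x ∈ P := by
      rw [← hσP]; exact Ideal.smul_mem_pointwise_smul _ _ _ hx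
    -- otherwise `P` contains `θ - a` or `θ + a` together with its conjugate, hence `2a`
    have h2a : ((2 * a : ℤ) : 𝓞 K) ∈ P := by
      have hmem : (θ - a) * (θ + a) ∈ P := by
        have : ((n - a ^ 2 : ℤ) : 𝓞 K) ∈ P := by
          rw [intCast_mem_iff_of_liesOver (q := q), ← ZMod.intCast_zmod_eq_zero_iff_dvd]
          push_cast
          linear_combination hs
        convert this using 1
        push_cast
        linear_combination hθ
      rcases hP.mem_or_mem hmem with h | h
      · have h' := hstab _ h
        rw [smul_sub, hσθ, hint] at h'
        have := P.neg_mem (P.add_mem h h')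
        convert this using 1
        push_cast
        ring
      · have h' := hstab _ h
        rw [smul_add, hσθ, hint] at h'
        have := P.add_mem h h'
        convert this using 1
        push_cast
        ring
    rw [intCast_mem_iff_of_liesOver (q := q), ← ZMod.intCast_zmod_eq_zero_iff_dvd] at h2a
    push_cast at h2a
    rcases mul_eq_zero.mp h2a with h | h
    · exact ZMod.two_ne_zero_of_ne_two hq h
    · rw [h, mul_zero] at hs
      exact hn hs

theorem splitsIn_iff {p q : ℕ} (hp : p.Prime) [Fact q.Prime] (hq : q ≠ 2)
    (hpq : (p : ZMod q) ≠ 0) : SplitsIn p q ↔ IsSquare (p : ZMod q) := by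
  have hr : (√(p : ℝ)) ^ 2 = p := Real.sq_sqrt p.cast_nonneg
  have hirr : √(p : ℝ) ∉ Set.range (algebraMap ℚ ℝ) := hp.irrational_sqrt
  have hint : IsIntegral ℤ √(p : ℝ) :=
    ⟨Polynomial.X ^ 2 - Polynomial.C (p : ℤ), Polynomial.monic_X_pow_sub_C _ two_ne_zero, by
      simp [hr]⟩
  have hintQ : IsIntegral ℚ √(p : ℝ) := hint.tower_top
  have hmin : minpoly ℚ √(p : ℝ) = Polynomial.X ^ 2 - Polynomial.C (p : ℚ) := by
    refine (minpoly.eq_of_irreducible_of_monic ?_ (by simp [hr])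
      (Polynomial.monic_X_pow_sub_C _ two_ne_zero)).symm
    rw [X_pow_sub_C_irreducible_iff_of_prime Nat.prime_two]
    intro b hb
    apply hirr
    have : (b : ℝ) ^ 2 = (√(p : ℝ)) ^ 2 := by rw [hr]; exact_mod_cast hb
    rcases sq_eq_sq_iff_eq_or_eq_neg.mp this with h | h
    · exact ⟨b, h⟩
    · exact ⟨-b, by rw [map_neg]; simp [h]⟩
  have : FiniteDimensional ℚ ℚ⟮√(p : ℝ)⟯ := IntermediateField.adjoin.finiteDimensional hintQ
  have : NumberField ℚ⟮√(p : ℝ)⟯ := ⟨⟩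
  have : Algebra.IsQuadraticExtension ℚ ℚ⟮√(p : ℝ)⟯ := ⟨by
    rw [IntermediateField.adjoin.finrank hintQ, hmin, Polynomial.natDegree_X_pow_sub_C]⟩
  have hgen : IsIntegral ℤ (IntermediateField.AdjoinSimple.gen ℚ √(p : ℝ)) :=
    (isIntegral_algHom_iff (ℚ⟮√(p : ℝ)⟯.val.restrictScalars ℤ) Subtype.val_injective).mp hint
  have hn : (((p : ℤ) : ℤ) : ZMod q) ≠ 0 := by simpa using hpq
  obtain ⟨θ, hθ⟩ : ∃ θ : 𝓞 ℚ⟮√(p : ℝ)⟯,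
    algebraMap (𝓞 ℚ⟮√(p : ℝ)⟯) ℚ⟮√(p : ℝ)⟯ θ = IntermediateField.AdjoinSimple.gen ℚ √(p : ℝ) :=
    ⟨⟨_, hgen⟩, rfl⟩
  have hθ2 : θ ^ 2 = ((p : ℤ) : 𝓞 ℚ⟮√(p : ℝ)⟯) := by
    apply FaithfulSMul.algebraMap_injective (𝓞 ℚ⟮√(p : ℝ)⟯) ℚ⟮√(p : ℝ)⟯
    rw [map_pow, map_intCast, hθ]
    apply Subtype.ext
    simp
  rw [SplitsIn, ncard_primesOver_eq_two_iff (n := p) hθ2 ?_ hq hn, Int.cast_natCast]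
  rintro ⟨b, hb⟩
  exact hirr ⟨b, congrArg Subtype.val (hb.trans hθ)⟩

end Splitting

/-! ### Squarefree parts and residue symbols -/

section Arithmetic

theorem Nat.Prime.dvd_plusPart_iff {D : ℤ} (hD : D ≠ 0) {q : ℕ} (hq : q.Prime) :
    q ∣ plusPart D ↔ (q : ℤ) ∣ D ∧ q % 4 = 1 := by
  rw [plusPart, hq.prime.dvd_finsetProd_iff]
  simp only [Finset.mem_filter, Nat.mem_primeFactors, Int.natCast_dvd]
  constructor
  · rintro ⟨a, ⟨⟨ha, h1, -⟩, h2⟩, h⟩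
    rw [(Nat.prime_dvd_prime_iff_eq hq ha).mp h]
    exact ⟨h1, h2⟩
  · rintro ⟨h1, h2⟩
    exact ⟨q, ⟨⟨hq, h1, by simpa using hD⟩, h2⟩, dvd_rfl⟩

theorem Nat.Prime.dvd_splitPart_iff {p : ℕ} {M : ℤ} (hM : M ≠ 0) {q : ℕ} (hq : q.Prime) :
    q ∣ splitPart p M ↔ (q : ℤ) ∣ M ∧ SplitsIn p q := by
  rw [splitPart, hq.prime.dvd_finsetProd_iff]
  simp only [Finset.mem_filter, Nat.mem_primeFactors, Int.natCast_dvd]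
  constructor
  · rintro ⟨a, ⟨⟨ha, h1, -⟩, h2⟩, h⟩
    rw [(Nat.prime_dvd_prime_iff_eq hq ha).mp h]
    exact ⟨h1, h2⟩
  · rintro ⟨h1, h2⟩
    exact ⟨q, ⟨⟨hq, h1, by simpa using hM⟩, h2⟩, dvd_rfl⟩

theorem plusPart_dvd (D : ℤ) : (plusPart D : ℤ) ∣ D := by
  rw [Int.natCast_dvd]
  exact (Finset.prod_dvd_prod_of_subset _ _ _ (Finset.filter_subset _ _)).trans
    (Nat.prod_primeFactors_dvd _)

theorem splitPart_dvd (p : ℕ) (M : ℤ) : splitPart p M ∣ M.natAbs := by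
  classical
  exact (Finset.prod_dvd_prod_of_subset _ _ _ (Finset.filter_subset _ _)).trans
    (Nat.prod_primeFactors_dvd _)

theorem dvd_plusPart {d M : ℤ} (hd : Squarefree d) (hM : M ≠ 0)
    (h : ∀ q : ℕ, q.Prime → (q : ℤ) ∣ d → (q : ℤ) ∣ M ∧ q % 4 = 1) : d ∣ plusPart M := by
  rw [← Int.natAbs_dvd, Int.natCast_dvd_natCast,
    ← Nat.prod_primeFactors_of_squarefree (Int.squarefree_natAbs.mpr hd)]
  refine Finset.prod_dvd_prod_of_subset _ _ _ fun q hq => ?_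
  have hq' := Nat.mem_primeFactors.mp hq
  obtain ⟨h1, h2⟩ := h q hq'.1 (Int.natCast_dvd.mpr hq'.2.1)
  exact Finset.mem_filter.mpr
    ⟨Nat.mem_primeFactors.mpr ⟨hq'.1, Int.natCast_dvd.mp h1, by simpa using hM⟩, h2⟩

theorem Nat.mod_four_eq_one_of_forall_prime {n : ℕ} (hn : n ≠ 0)
    (h : ∀ q : ℕ, q.Prime → q ∣ n → q % 4 = 1) : n % 4 = 1 := by
  induction n using Nat.recOnMul with
  | zero => exact absurd rfl hn
  | one => rfl
  | prime q hq => exact h q hq dvd_rfl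
  | mul a b ha hb =>
    rw [Nat.mul_mod, ha (left_ne_zero_of_mul hn) fun q hq hqa => h q hq (hqa.mul_right b),
      hb (right_ne_zero_of_mul hn) fun q hq hqb => h q hq (hqb.mul_left a)]

theorem Nat.Prime.dvd_div_gcd_iff {N e q : ℕ} (hq : q.Prime) (hN : Squarefree N) :
    q ∣ N / N.gcd e ↔ q ∣ N ∧ ¬ q ∣ e := by
  have hmul : N.gcd e * (N / N.gcd e) = N := Nat.mul_div_cancel' (Nat.gcd_dvd_left N e)
  constructor
  · intro h
    have hqN : q ∣ N := hmul ▸ h.mul_left _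
    refine ⟨hqN, fun he => hq.one_lt.ne' ?_⟩
    exact Nat.isUnit_iff.mp (hN q (hmul ▸ mul_dvd_mul (Nat.dvd_gcd hqN he) h))
  · rintro ⟨h1, h2⟩
    rw [← hmul] at h1
    exact (hq.dvd_mul.mp h1).resolve_left fun h => h2 (h.trans (Nat.gcd_dvd_right _ _))

theorem jacobiSym_eq_one_iff_isSquare {q : ℕ} [Fact q.Prime] {a : ℤ} (ha : (a : ZMod q) ≠ 0) :
    jacobiSym a q = 1 ↔ IsSquare (a : ZMod q) := by
  rw [← jacobiSym.legendreSym.to_jacobiSym, legendreSym.eq_one_iff q ha]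

theorem jacobiSym_eq_iff_isSquare_mul {q : ℕ} [Fact q.Prime] {a b : ℤ} (ha : (a : ZMod q) ≠ 0)
    (hb : (b : ZMod q) ≠ 0) : jacobiSym a q = jacobiSym b q ↔ IsSquare ((a : ZMod q) * b) := by
  have hab : ((a * b : ℤ) : ZMod q) ≠ 0 := by push_cast; exact mul_ne_zero ha hb
  have h := jacobiSym_eq_one_iff_isSquare hab
  rw [Int.cast_mul] at h
  rw [← h, jacobiSym.mul_left, ← jacobiSym.legendreSym.to_jacobiSym,
    ← jacobiSym.legendreSym.to_jacobiSym]
  rcases legendreSym.eq_one_or_neg_one q ha with h1 | h1 <;>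
  rcases legendreSym.eq_one_or_neg_one q hb with h2 | h2 <;> rw [h1, h2] <;> norm_num

theorem exists_squarefree_mul_sq (x : ℚˣ) :
    ∃ (D : ℤ) (y : ℚˣ), Squarefree D ∧ (x : ℚ) = D * (y : ℚ) ^ 2 := by
  obtain ⟨a, b, hab, ha⟩ := Nat.sq_mul_squarefree ((x : ℚ).num * (x : ℚ).den).natAbs
  have hden : ((x : ℚ).den : ℚ) ≠ 0 := by exact_mod_cast (x : ℚ).den_ne_zero
  have hnum : (x : ℚ).num ≠ 0 := Rat.num_ne_zero.mpr x.ne_zero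
  have hb : (b : ℚ) ≠ 0 := by
    rintro h
    have hb0 : b = 0 := by exact_mod_cast h
    rw [hb0, zero_pow two_ne_zero, zero_mul, eq_comm, Int.natAbs_eq_zero] at hab
    exact mul_ne_zero hnum (by exact_mod_cast (x : ℚ).den_ne_zero) hab
  have hx : (x : ℚ) * (x : ℚ).den = (x : ℚ).num := Rat.mul_den_eq_num _
  have hx2 : (x : ℚ) * ((x : ℚ).den) ^ 2 = ((x : ℚ).num * (x : ℚ).den : ℤ) := by
    push_cast; rw [← hx]; ring
  have hab' : ((b ^ 2 * a : ℕ) : ℤ) = (((x : ℚ).num * (x : ℚ).den).natAbs : ℤ) := by rw [hab]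
  rcases Int.natAbs_eq ((x : ℚ).num * (x : ℚ).den) with h | h
  · refine ⟨a, Units.mk0 (b / (x : ℚ).den) (div_ne_zero hb hden),
      Int.squarefree_natCast.mpr ha, ?_⟩
    rw [h, ← hab'] at hx2
    push_cast at hx2
    rw [Units.val_mk0]
    field_simp
    rw [hx2]
    push_cast
    ring
  · refine ⟨-a, Units.mk0 (b / (x : ℚ).den) (div_ne_zero hb hden),
      Int.squarefree_natAbs.mp (by simpa using ha), ?_⟩
    rw [h, ← hab'] at hx2
    push_cast at hx2
    rw [Units.val_mk0]
    field_simp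
    rw [hx2]
    push_cast
    ring

end Arithmetic

/-! ### Everywhere local solubility -/

section Global

variable {p : ℕ} {u M d : ℤ}

/-- Everywhere local solubility of the torsor attached to a squarefree `d` prime to `p` gives the
conditions describing the Selmer group, each from one prime. -/
theorem conditions_of_torsorSoluble (hp : p.Prime) (hpu : (p : ℤ) = u ^ 2 + 64)
    (hu : u ≡ 1 [ZMOD 4]) (hodd : Odd M) (hM : Squarefree M) (hcop : IsCoprime M (p : ℤ))
    (hd : Squarefree d) (hpd : ¬ (p : ℤ) ∣ d) (hR : TorsorSoluble u M d ℝ)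
    (hQ : ∀ (q : ℕ) [Fact q.Prime], TorsorSoluble u M d ℚ_[q]) :
    (d ∣ plusPart M ∧ 0 < d) ∧
      ((M ≡ 1 [ZMOD 4] → d ≡ 1 [ZMOD 4]) ∧ (M ≡ 3 [ZMOD 4] → d ≡ 1 [ZMOD 8])) ∧
      ((∀ q : ℕ, q.Prime → q ∣ splitPart p M / Nat.gcd (splitPart p M) d.natAbs →
          jacobiSym d q = 1) ∧
        (∀ q : ℕ, q.Prime → q ∣ Nat.gcd (plusPart (splitPart p M)) d.natAbs →
          ∃ b : ℤ, b ^ 2 ≡ -1 [ZMOD q] ∧ jacobiSym (M / d) q = jacobiSym (u + 8 * b) q)) := by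
  have hd0 : d ≠ 0 := hd.ne_zero
  have hM0 : M ≠ 0 := hM.ne_zero
  have hsq (n : ℤ) (hn : Squarefree n) (q : ℕ) (hq : q.Prime) : ¬ (q : ℤ) ^ 2 ∣ n := by
    intro h
    rw [sq] at h
    exact (Nat.prime_iff_prime_int.mp hq).not_isUnit (hn _ h)
  have hloc (q : ℕ) (hq : q.Prime) (hqM : (q : ℤ) ∣ M) :
      q ≠ 2 ∧ ((u ^ 2 + 64 : ℤ) : ZMod q) ≠ 0 ∧
        (SplitsIn p q ↔ IsSquare ((u ^ 2 + 64 : ℤ) : ZMod q)) := by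
    have : Fact q.Prime := ⟨hq⟩
    have hq2 : q ≠ 2 := by
      rintro rfl
      exact (Int.not_even_iff_odd.mpr hodd) (even_iff_two_dvd.mpr (by exact_mod_cast hqM))
    have hqp : (p : ZMod q) ≠ 0 := by
      rw [Ne, ZMod.natCast_eq_zero_iff]
      intro h
      exact (Nat.prime_iff_prime_int.mp hq).not_isUnit
        (hcop.isUnit_of_dvd' hqM (Int.natCast_dvd_natCast.mpr h))
    rw [← hpu, Int.cast_natCast]
    exact ⟨hq2, hqp, splitsIn_iff hp hq2 hqp⟩
  have hpos : 0 < d := (torsorSoluble_real_iff hM0 hd0).mp hR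
  have hdiv (q : ℕ) (hq : q.Prime) (hqd : (q : ℤ) ∣ d) : (q : ℤ) ∣ M ∧ q % 4 = 1 := by
    have : Fact q.Prime := ⟨hq⟩
    have hqM : (q : ℤ) ∣ M := by
      by_contra h
      refine (hQ q).not_dvd (hsq d hd q hq) h ?_ hqd
      rw [← hpu, Int.natCast_dvd_natCast, Nat.prime_dvd_prime_iff_eq hq hp]
      rintro rfl
      exact hpd hqd
    refine ⟨hqM, ?_⟩
    obtain ⟨hq2, -, -⟩ := hloc q hq hqM
    obtain ⟨M', hM'⟩ := hqM
    obtain ⟨d', hd'⟩ := hqd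
    have hM'0 : (M' : ZMod q) ≠ 0 := by
      rw [Ne, ZMod.intCast_zmod_eq_zero_iff_dvd]
      exact fun h => hsq M hM q hq (by rw [hM', sq]; exact mul_dvd_mul_left _ h)
    have hd'0 : (d' : ZMod q) ≠ 0 := by
      rw [Ne, ZMod.intCast_zmod_eq_zero_iff_dvd]
      exact fun h => hsq d hd q hq (by rw [hd', sq]; exact mul_dvd_mul_left _ h)
    obtain ⟨b, hb, -⟩ := TorsorSoluble.exists_sq_eq_neg_one hq2 hd'0 hM'0
      (by rw [← hM', ← hd']; exact hQ q)
    have h3 : q % 4 ≠ 3 := ZMod.exists_sq_eq_neg_one_iff.mp ⟨b, by rw [← hb, sq]⟩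
    have := hq.eq_two_or_odd
    omega
  have hdM : d ∣ M := (dvd_plusPart hd hM0 hdiv).trans (plusPart_dvd M)
  have hd4 : d % 4 = 1 := by
    have := Nat.mod_four_eq_one_of_forall_prime (n := d.natAbs) (by simpa using hd0)
      fun q hq h => (hdiv q hq (Int.natCast_dvd.mpr h)).2
    omega
  refine ⟨⟨dvd_plusPart hd hM0 hdiv, hpos⟩, ⟨fun _ => hd4, fun hM3 => ?_⟩, ?_, ?_⟩
  · by_contra h
    exact not_torsorSoluble_two (by rw [Int.ModEq] at h ⊢; omega) hu hM3 (hQ 2)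
  · intro q hq h
    have : Fact q.Prime := ⟨hq⟩
    have hN : Squarefree (splitPart p M) :=
      (Int.squarefree_natAbs.mpr hM).squarefree_of_dvd (splitPart_dvd p M)
    obtain ⟨h1, h2⟩ := (hq.dvd_div_gcd_iff hN).mp h
    obtain ⟨hqM, hs⟩ := (hq.dvd_splitPart_iff hM0).mp h1
    obtain ⟨-, hp0, hiff⟩ := hloc q hq hqM
    have hdq : (d : ZMod q) ≠ 0 := by
      rwa [Ne, ZMod.intCast_zmod_eq_zero_iff_dvd, Int.natCast_dvd]
    obtain ⟨M', hM'⟩ := hqM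
    have hM'0 : (M' : ZMod q) ≠ 0 := by
      rw [Ne, ZMod.intCast_zmod_eq_zero_iff_dvd]
      exact fun h => hsq M hM q hq (by rw [hM', sq]; exact mul_dvd_mul_left _ h)
    rw [jacobiSym_eq_one_iff_isSquare hdq]
    exact TorsorSoluble.isSquare_zmod hdq hM'0 hp0 (hiff.mp hs) (by rw [← hM']; exact hQ q)
  · intro q hq h
    have : Fact q.Prime := ⟨hq⟩
    have hqd : (q : ℤ) ∣ d := Int.natCast_dvd.mpr (h.trans (Nat.gcd_dvd_right _ _))
    obtain ⟨hq2, hp0, -⟩ := hloc q hq (hqd.trans hdM)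
    obtain ⟨m, hm⟩ := hdM
    obtain ⟨d', hd'⟩ := hqd
    have hM' : M = q * (d' * m) := by rw [hm, hd']; ring
    have hM'0 : ((d' * m : ℤ) : ZMod q) ≠ 0 := by
      rw [Ne, ZMod.intCast_zmod_eq_zero_iff_dvd]
      exact fun h => hsq M hM q hq (by rw [hM', sq]; exact mul_dvd_mul_left _ h)
    have hd'0 : (d' : ZMod q) ≠ 0 := fun h => hM'0 (by rw [Int.cast_mul, h, zero_mul])
    have hm0 : (m : ZMod q) ≠ 0 := fun h => hM'0 (by rw [Int.cast_mul, h, mul_zero])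
    obtain ⟨b, hb, s, hs⟩ := TorsorSoluble.exists_sq_eq_neg_one hq2 hd'0 hM'0
      (by rw [← hM', ← hd']; exact hQ q)
    obtain ⟨b, rfl⟩ := ZMod.intCast_surjective b
    have hub : ((u + 8 * b : ℤ) : ZMod q) ≠ 0 := by
      intro h0
      push_cast at h0 hp0
      exact hp0 (by linear_combination (u - 8 * b : ZMod q) * h0 + 64 * hb)
    refine ⟨b, (ZMod.intCast_eq_intCast_iff _ _ q).mp (by push_cast; exact hb), ?_⟩
    rw [hm, Int.mul_ediv_cancel_left _ hd0, jacobiSym_eq_iff_isSquare_mul hm0 hub]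
    refine ⟨s / d', ?_⟩
    push_cast at hs ⊢
    field_simp
    linear_combination hs

/-- Conversely the conditions give solubility at every prime: at `2` by the congruences, at the
primes dividing `M` by the residue symbols, and at all other primes automatically. -/
theorem torsorSoluble_of_conditions (hp : p.Prime) (hpu : (p : ℤ) = u ^ 2 + 64)
    (hu : u ≡ 1 [ZMOD 4]) (hodd : Odd M) (hM : Squarefree M) (hcop : IsCoprime M (p : ℤ))
    (hdiv : d ∣ plusPart M) (h1 : M ≡ 1 [ZMOD 4] → d ≡ 1 [ZMOD 4])
    (h3 : M ≡ 3 [ZMOD 4] → d ≡ 1 [ZMOD 8])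
    (hN : ∀ q : ℕ, q.Prime → q ∣ splitPart p M / Nat.gcd (splitPart p M) d.natAbs →
      jacobiSym d q = 1)
    (hNp : ∀ q : ℕ, q.Prime → q ∣ Nat.gcd (plusPart (splitPart p M)) d.natAbs →
      ∃ b : ℤ, b ^ 2 ≡ -1 [ZMOD q] ∧ jacobiSym (M / d) q = jacobiSym (u + 8 * b) q)
    (q : ℕ) [hq : Fact q.Prime] : TorsorSoluble u M d ℚ_[q] := by
  have hM0 : M ≠ 0 := hM.ne_zero
  have hdM : d ∣ M := hdiv.trans (plusPart_dvd M)
  have hd0 : d ≠ 0 := ne_zero_of_dvd_ne_zero hM0 hdM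
  have hsq : ¬ (q : ℤ) ^ 2 ∣ M := by
    intro h
    rw [sq] at h
    exact (Nat.prime_iff_prime_int.mp hq.out).not_isUnit (hM _ h)
  by_cases hq2 : q = 2
  · subst hq2
    have hM2 := Int.odd_iff.mp hodd
    by_cases h8 : d ≡ 1 [ZMOD 8]
    · exact torsorSoluble_two_of_modEq_one h8
    · have hM4 : M ≡ 1 [ZMOD 4] := by
        by_contra h
        exact h8 (h3 (by rw [Int.ModEq] at h ⊢; omega))
      have hd4 := h1 hM4
      exact torsorSoluble_two_of_modEq_five (by rw [Int.ModEq] at h8 hd4 ⊢; omega)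
        (by simpa using hu.mul hM4)
  by_cases hqM : (q : ℤ) ∣ M
  swap
  · refine torsorSoluble_of_not_dvd hq2 ?_ ?_ <;> rw [Ne, ZMod.intCast_zmod_eq_zero_iff_dvd]
    · exact fun h => hqM (h.trans hdM)
    · exact hqM
  have hqp : (p : ZMod q) ≠ 0 := by
    rw [Ne, ZMod.natCast_eq_zero_iff]
    intro h
    exact (Nat.prime_iff_prime_int.mp hq.out).not_isUnit
      (hcop.isUnit_of_dvd' hqM (Int.natCast_dvd_natCast.mpr h))
  have hsplit := splitsIn_iff hp hq2 hqp
  have hpc : ((u ^ 2 + 64 : ℤ) : ZMod q) = p := by rw [← hpu, Int.cast_natCast]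
  have hNsq : Squarefree (splitPart p M) :=
    (Int.squarefree_natAbs.mpr hM).squarefree_of_dvd (splitPart_dvd p M)
  by_cases hqd : (q : ℤ) ∣ d
  swap
  · have hdq : (d : ZMod q) ≠ 0 := by rwa [Ne, ZMod.intCast_zmod_eq_zero_iff_dvd]
    by_cases hs : IsSquare (p : ZMod q)
    · refine Or.inl (Padic.isSquare_intCast_of_zmod hq2 hdq ?_)
      rw [← jacobiSym_eq_one_iff_isSquare hdq]
      exact hN q hq.out ((hq.out.dvd_div_gcd_iff hNsq).mpr
        ⟨(hq.out.dvd_splitPart_iff hM0).mpr ⟨hqM, hsplit.mpr hs⟩, by rwa [← Int.natCast_dvd]⟩)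
    · exact torsorSoluble_of_not_isSquare hq2 hdq (by rwa [hpc])
  · have hq4 : q % 4 = 1 :=
      ((hq.out.dvd_plusPart_iff hM0).mp (Int.natCast_dvd_natCast.mp (hqd.trans hdiv))).2
    obtain ⟨m, hm⟩ := hdM
    obtain ⟨d', hd'⟩ := id hqd
    have hM' : M = q * (d' * m) := by rw [hm, hd']; ring
    have hM'0 : ((d' * m : ℤ) : ZMod q) ≠ 0 := by
      rw [Ne, ZMod.intCast_zmod_eq_zero_iff_dvd]
      exact fun h => hsq (by rw [hM', sq]; exact mul_dvd_mul_left _ h)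
    have hd'0 : (d' : ZMod q) ≠ 0 := fun h => hM'0 (by rw [Int.cast_mul, h, zero_mul])
    have hm0 : (m : ZMod q) ≠ 0 := fun h => hM'0 (by rw [Int.cast_mul, h, mul_zero])
    suffices h : ∃ b : ZMod q, b ^ 2 = -1 ∧ IsSquare ((m : ZMod q) * (u + 8 * b)) by
      obtain ⟨b, hb, h⟩ := h
      rw [hM', hd']
      exact torsorSoluble_of_dvd hq2 hd'0 hm0 (by rwa [hpc]) hb h
    by_cases hs : IsSquare (p : ZMod q)
    · have hqN : q ∣ splitPart p M := (hq.out.dvd_splitPart_iff hM0).mpr ⟨hqM, hsplit.mpr hs⟩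
      obtain ⟨b, hb, h⟩ := hNp q hq.out (Nat.dvd_gcd
        ((hq.out.dvd_plusPart_iff (by exact_mod_cast hNsq.ne_zero)).mpr
          ⟨Int.natCast_dvd_natCast.mpr hqN, hq4⟩) (Int.natCast_dvd.mp hqd))
      have hb' : (b : ZMod q) ^ 2 = -1 := by
        have := (ZMod.intCast_eq_intCast_iff _ _ q).mpr hb
        push_cast at this
        exact this
      have hub : ((u + 8 * b : ℤ) : ZMod q) ≠ 0 := by
        intro h0
        push_cast at h0
        refine hqp (hpc ▸ ?_)
        push_cast
        linear_combination (u - 8 * b : ZMod q) * h0 + 64 * hb'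
      rw [hm, Int.mul_ediv_cancel_left _ hd0, jacobiSym_eq_iff_isSquare_mul hm0 hub] at h
      exact ⟨b, hb', by push_cast at h; exact h⟩
    · -- `(u + 8b) (u - 8b) = p` is not a square, so `b` or `-b` is a suitable square root of `-1`
      obtain ⟨b, hb⟩ := ZMod.exists_sq_eq_neg_one_iff (p := q).mpr (by omega)
      by_cases h : IsSquare ((m : ZMod q) * (u + 8 * b))
      · exact ⟨b, by rw [sq, hb], h⟩
      · refine ⟨-b, by rw [neg_sq, sq, hb], ?_⟩
        by_contra h'
        obtain ⟨s, hs'⟩ := isSquare_mul_of_not_isSquare h h'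
        refine hs ⟨s / m, ?_⟩
        rw [← hpc]
        push_cast
        field_simp
        linear_combination hs' - 64 * (m : ZMod q) ^ 2 * hb

end Global

/-! ### The Selmer group -/

section Selmer

variable {u M : ℤ} {hM : M ≠ 0}

/-- The class of `x` dies in `H¹(ℚ_v, A')` for every place `v` of `ℚ`. -/
def IsTrivialEverywhere (u : ℤ) (hM : M ≠ 0) (x : ℚˣ) : Prop :=
  IsTrivialOver u hM x ℝ ∧ ∀ (q : ℕ) [Fact q.Prime], IsTrivialOver u hM x ℚ_[q]

theorem mem_phiHatSelmer_iff {c : SquareClassGroup} :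
    c ∈ phiHatSelmer u hM ↔ ∃ x, IsTrivialEverywhere u hM x ∧ QuotientGroup.mk x = c :=
  Iff.rfl

theorem IsTrivialEverywhere.mul {x y : ℚˣ} (hx : IsTrivialEverywhere u hM x)
    (hy : IsTrivialEverywhere u hM y) : IsTrivialEverywhere u hM (x * y) :=
  ⟨hx.1.mul hy.1, fun q _ => (hx.2 q).mul (hy.2 q)⟩

theorem IsTrivialEverywhere.inv {x : ℚˣ} (hx : IsTrivialEverywhere u hM x) :
    IsTrivialEverywhere u hM x⁻¹ :=
  ⟨hx.1.inv, fun q _ => (hx.2 q).inv⟩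

theorem isTrivialEverywhere_sq (y : ℚˣ) : IsTrivialEverywhere u hM (y ^ 2) := by
  have h (K : Type) [Field K] [Algebra ℚ K] : IsTrivialOver u hM (y ^ 2) K :=
    isTrivialOver_of_isSquare ⟨algebraMap ℚ K y, by rw [← map_mul, Units.val_pow_eq_pow_val, sq]⟩
  exact ⟨h ℝ, fun q _ => h ℚ_[q]⟩

/-- The class of `p` is the image of the point `(0, 0)` of `A`. -/
theorem isTrivialEverywhere_of_eq {x : ℚˣ} (hx : (x : ℚ) = u ^ 2 + 64) :
    IsTrivialEverywhere u hM x := by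
  have h (K : Type) [Field K] [Algebra ℚ K] : IsTrivialOver u hM x K := by
    refine isTrivialOver_of_torsor_point (z := 0) (w := M) ?_
    rw [hx]
    simp only [map_add, map_pow, map_intCast, map_ofNat]
    ring
  exact ⟨h ℝ, fun q _ => h ℚ_[q]⟩

theorem isTrivialEverywhere_iff {x : ℚˣ} {d : ℤ} (hx : (x : ℚ) = d) :
    IsTrivialEverywhere u hM x ↔ TorsorSoluble u M d ℝ ∧
      ∀ (q : ℕ) [Fact q.Prime], TorsorSoluble u M d ℚ_[q] := by
  simp only [IsTrivialEverywhere, isTrivialOver_iff_torsorSoluble hx]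

theorem squareClass_mk_eq {x y z : ℚˣ} (h : x = y * z ^ 2) :
    (QuotientGroup.mk x : SquareClassGroup) = QuotientGroup.mk y := by
  rw [eq_comm, QuotientGroup.eq]
  exact ⟨z, by rw [h]; simp⟩

end Selmer

theorem mainTheorem11 (p : ℕ) (hp : p.Prime) (u : ℤ) (hpu : (p : ℤ) = u ^ 2 + 64)
    (hu : u ≡ 1 [ZMOD 4]) (M : ℤ) (hodd : Odd M) (hM : Squarefree M)
    (hcop : IsCoprime M (p : ℤ)) (c : SquareClassGroup) :
    c ∈ phiHatSelmer u hM.ne_zero ↔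
      ∃ d : ℤ,
        (d ∣ plusPart M ∧ 0 < d) ∧
        ((M ≡ 1 [ZMOD 4] → d ≡ 1 [ZMOD 4]) ∧ (M ≡ 3 [ZMOD 4] → d ≡ 1 [ZMOD 8])) ∧
        ((∀ q : ℕ, q.Prime → q ∣ splitPart p M / Nat.gcd (splitPart p M) d.natAbs →
            jacobiSym d q = 1) ∧
          (∀ q : ℕ, q.Prime → q ∣ Nat.gcd (plusPart (splitPart p M)) d.natAbs →
            ∃ b : ℤ, b ^ 2 ≡ -1 [ZMOD q] ∧ jacobiSym (M / d) q = jacobiSym (u + 8 * b) q)) ∧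
        ∃ x : ℚˣ, ((x : ℚ) = d ∨ (x : ℚ) = p * d) ∧ c = QuotientGroup.mk x := by
  have hpQ : (p : ℚ) = u ^ 2 + 64 := by exact_mod_cast hpu
  have hp0 : (p : ℚ) ≠ 0 := by exact_mod_cast hp.ne_zero
  have hpi : Prime (p : ℤ) := Nat.prime_iff_prime_int.mp hp
  let π : ℚˣ := Units.mk0 (p : ℚ) hp0
  have hπ : IsTrivialEverywhere u hM.ne_zero π := isTrivialEverywhere_of_eq hpQ
  rw [mem_phiHatSelmer_iff]
  constructor
  · rintro ⟨x, hx, rfl⟩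
    obtain ⟨D, y, hD, hxD⟩ := exists_squarefree_mul_sq x
    -- the part of `D` prime to `p`
    obtain ⟨d, hd, hpd, hDd⟩ : ∃ d : ℤ, Squarefree d ∧ ¬ (p : ℤ) ∣ d ∧ (D = d ∨ D = p * d) := by
      by_cases h : (p : ℤ) ∣ D
      · obtain ⟨d, rfl⟩ := h
        exact ⟨d, hD.of_mul_right, fun h => hpi.not_isUnit (hD _ (mul_dvd_mul_left _ h)),
          Or.inr rfl⟩
      · exact ⟨D, hD, h, Or.inl rfl⟩
    have hd0 : (d : ℚ) ≠ 0 := by exact_mod_cast hd.ne_zero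
    let δ : ℚˣ := Units.mk0 (d : ℚ) hd0
    obtain ⟨ε, hε, hεd, hxε⟩ : ∃ ε : ℚˣ, (ε = δ ∨ ε = π * δ) ∧
        ((ε : ℚ) = d ∨ (ε : ℚ) = p * d) ∧ x = ε * y ^ 2 := by
      rcases hDd with rfl | rfl
      · exact ⟨δ, Or.inl rfl, Or.inl rfl, Units.ext (by simpa [δ] using hxD)⟩
      · exact ⟨π * δ, Or.inr rfl, Or.inr rfl, Units.ext (by simpa [π, δ] using hxD)⟩
    have hεt : IsTrivialEverywhere u hM.ne_zero ε := by
      rw [← mul_inv_eq_iff_eq_mul] at hxε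
      exact hxε ▸ hx.mul (isTrivialEverywhere_sq y).inv
    have hδ : IsTrivialEverywhere u hM.ne_zero δ := by
      rcases hε with rfl | rfl
      · exact hεt
      · simpa using hπ.inv.mul hεt
    obtain ⟨hR, hQ⟩ := (isTrivialEverywhere_iff (d := d) rfl).mp hδ
    obtain ⟨h1, h2, h3⟩ := conditions_of_torsorSoluble hp hpu hu hodd hM hcop hd hpd hR hQ
    exact ⟨d, h1, h2, h3, ε, hεd, squareClass_mk_eq hxε⟩
  · rintro ⟨d, ⟨hdiv, hpos⟩, ⟨h1, h3⟩, ⟨hN, hNp⟩, x, hx, rfl⟩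
    refine ⟨x, ?_, rfl⟩
    have hd0 : (d : ℚ) ≠ 0 := by exact_mod_cast hpos.ne'
    let δ : ℚˣ := Units.mk0 (d : ℚ) hd0
    have hδ : IsTrivialEverywhere u hM.ne_zero δ :=
      (isTrivialEverywhere_iff (d := d) rfl).mpr
        ⟨(torsorSoluble_real_iff hM.ne_zero hpos.ne').mpr hpos, fun q _ =>
          torsorSoluble_of_conditions hp hpu hu hodd hM hcop hdiv h1 h3 hN hNp q⟩
    rcases hx with hx | hx
    · rwa [show x = δ from Units.ext hx]
    · rw [show x = π * δ from Units.ext hx]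
      exact hπ.mul hδ
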